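/- For each sample size $n$ let $(Y_i,X_i)$, $i=1,\dots,n$, be i.i.d. copies of $(Y,X)\in\mathbf R\times\mathbf R^{p}$ with law depending on $n$, where $p=p_n\ge 2$ may vary arbitrarily with $n$, and suppose $Y=X^\intercal\beta_0+\varepsilon$ with $\mathbb E_0[X\varepsilon]=0$, where $\beta_0=\beta_{0,n}\in\mathbf R^p$. Write $Z^{(n)}=\{Y_i,X_i\}_{i=1}^n$, $P_0$ for its law, $\Omega_0=\mathbb E_0[XX^\intercal]$ (assumed invertible), $\Theta_0=\Omega_0^{-1}$, $\hat\Omega_n=n^{-1}\sum_{i=1}^n X_iX_i^\intercal$, and $\varepsilon_i=Y_i-X_i^\intercal\beta_0$. For a matrix $A$, $\|A\|_{\max}$ is the largest absolute entry and $\|A\|_\infty$ the operator norm induced by the sup-norm. For a random variable, $\|U\|_{\psi_2}=\inf\{t>0:\mathbb E_0[\exp(U^2/t^2)]\le 2\}$; for a random vector, $\|V\|_{\psi_2}=\sup_{\|x\|_2=1}\|V^\intercal x\|_{\psi_2}$. Let $\Pi_\beta(\cdot\mid Z^{(n)})$ be any (exact or approximate) initial posterior for $\beta$, i.e. a Markov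 kernel from the data to $\mathbf R^p$, and let $\hat\Theta_n$ be any estimator of $\Theta_0$ that is a function of $Z^{(n)}$. Let $W_{ni}=\omega_i/\sum_{k=1}^n\omega_k$ with $\omega_1,\dots,\omega_n$ i.i.d. standard exponential. The debiased posterior is the law, given $Z^{(n)}$, of $$\tilde\beta=\beta+\hat\Theta_n\Big[\sum_{i=1}^nW_{ni}X_i(Y_i-X_i^\intercal\beta)\Big],\qquad \beta\sim\Pi_\beta(\cdot\mid Z^{(n)}),$$ with $\{W_{ni}\}_{i=1}^n$ independent of $\beta$ and of $Z^{(n)}$. Let $q_{n,j}(\tau)$ be the $\tau$th quantile of $\tilde\beta_j$ under this law, and $\mathcal C_{n,j}(\alpha)=[q_{n,j}(\alpha/2),\,q_{n,j}(1-\alpha/2)]$. Fix coordinates $j=j_n\in\{1,\dots,p_n\}$, and suppose: (1) there are a constant $C>0$ and positive $\epsilon_n\to0$ with $\mathbb E_0[\Pi_\beta(\|\beta-\beta_0\|_1\ge C\epsilon_n\mid Z^{(n)})]\to0$; (2) there are positive $\gamma_n\to0$ and $\delta_n\to0$ with $\|\hat\Theta_n\hat\Omega_n-I_p\|_{\max}=O_{P_0}(\gamma_n)$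 and $\|\hat\Theta_n-\Theta_0\|_\infty=O_{P_0}(\delta_n)$; (3) there is a function $\hat\beta_n$ of $Z^{(n)}$ with $\hat\beta_n=\beta_0+\Theta_0\frac1n\sum_{i=1}^nX_i\varepsilon_i+\Delta_n$ and $\|\Delta_n\|_\infty=o_{P_0}(n^{-1/2})$; (4) $\|X\|_{\psi_2}$ and $\|\varepsilon\|_{\psi_2}$ are positive and bounded uniformly in $n$, and $\mathbb E_0[|e_j^\intercal\Theta_0X\varepsilon|^3]$ is bounded uniformly in $n$; (5) $\sqrt n\,\epsilon_n\gamma_n\to0$ and $\sqrt n\,(\epsilon_n\|\Theta_0\|_\infty+\delta_n)\big(\sqrt{\log p/n}+(\log n)^2(\log p)^2/n\big)\to0$; (6) $\sigma_{0,j}^2:=e_j^\intercal\Theta_0\,\mathbb E_0[XX^\intercal\varepsilon^2]\,\Theta_0e_j$ is bounded away from zero uniformly in $n$. Then, for every $\alpha\in(0,1)$, $$P_0\big(\beta_{0,j}\in\mathcal C_{n,j}(\alpha)\big)\to1-\alpha\qquad(n\to\infty).$$ -/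

import Mathlib

open MeasureTheory ProbabilityTheory Filter Topology
open scoped ENNReal Matrix

noncomputable section

namespace DebiasedBayes

/-- One observation `(Y, X)`: a scalar response and a `p`-dimensional covariate vector. -/
abbrev Obs (p : ℕ) : Type := ℝ × (Fin p → ℝ)

/-- The data `Z⁽ⁿ⁾ = (Y_i, X_i)`, `i = 1, …, n`. -/
abbrev Sample (n p : ℕ) : Type := Fin n → Obs p

/-- The law `P₀` of the data: `n` i.i.d. copies of `(Y, X) ∼ μ`. -/
def sampleLaw {p : ℕ} (n : ℕ) (μ : Measure (Obs p)) : Measure (Sample n p) :=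
  Measure.pi fun _ => μ

/-- The regression error `ε = Y - Xᵀ β₀`. -/
def err {p : ℕ} (β₀ : Fin p → ℝ) (z : Obs p) : ℝ := z.1 - z.2 ⬝ᵥ β₀

/-- `Ω₀ = E₀[X Xᵀ]`. -/
def Omega0 {p : ℕ} (μ : Measure (Obs p)) : Matrix (Fin p) (Fin p) ℝ :=
  Matrix.of fun k l => ∫ z, z.2 k * z.2 l ∂μ

/-- The precision matrix `Θ₀ = Ω₀⁻¹`. -/
def Theta0 {p : ℕ} (μ : Measure (Obs p)) : Matrix (Fin p) (Fin p) ℝ := (Omega0 μ)⁻¹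

/-- `E₀[X Xᵀ ε²]`. -/
def scoreCov {p : ℕ} (μ : Measure (Obs p)) (β₀ : Fin p → ℝ) : Matrix (Fin p) (Fin p) ℝ :=
  Matrix.of fun k l => ∫ z, z.2 k * z.2 l * err β₀ z ^ 2 ∂μ

/-- `σ²_{0,j} = e_jᵀ Θ₀ E₀[X Xᵀ ε²] Θ₀ e_j`. -/
def sigmaSq {p : ℕ} (μ : Measure (Obs p)) (β₀ : Fin p → ℝ) (j : Fin p) : ℝ :=
  (Theta0 μ * scoreCov μ β₀ * Theta0 μ) j j

/-- `Ω̂_n = n⁻¹ ∑ X_i X_iᵀ`. -/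
def OmegaHat {n p : ℕ} (z : Sample n p) : Matrix (Fin p) (Fin p) ℝ :=
  Matrix.of fun k l => (n : ℝ)⁻¹ * ∑ i, (z i).2 k * (z i).2 l

/-- The `ℓ₁` norm of a vector. -/
def l1Norm {p : ℕ} (v : Fin p → ℝ) : ℝ := ∑ k, |v k|

/-- The elementwise sup-norm of a matrix (the norm used here is that of a finite product, which is
the maximum of the norms of the components). -/
def maxNorm {p : ℕ} (A : Matrix (Fin p) (Fin p) ℝ) : ℝ :=
  ‖(fun k l => A k l : Fin p → Fin p → ℝ)‖

/-- The operator norm of a matrix induced by the sup-norm on vectors (`Fin p → ℝ` carries the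
sup-norm). -/
def opNormInf {p : ℕ} (A : Matrix (Fin p) (Fin p) ℝ) : ℝ :=
  ‖LinearMap.toContinuousLinearMap (Matrix.toLin' A)‖

/-- The sub-Gaussian norm `inf {t > 0 : E[exp (U² / t²)] ≤ 2}` of a random variable; it is `∞` if
there is no such `t`. -/
def psi2Norm {Ω : Type*} [MeasurableSpace Ω] (μ : Measure Ω) (U : Ω → ℝ) : ℝ≥0∞ :=
  ⨅ (t : ℝ) (_ : 0 < t) (_ : ∫⁻ ω, ENNReal.ofReal (Real.exp (U ω ^ 2 / t ^ 2)) ∂μ ≤ 2),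
    ENNReal.ofReal t

/-- The sub-Gaussian norm of a random vector: the supremum of the sub-Gaussian norms of `Vᵀ x` over
all `x` of Euclidean length one. -/
def psi2NormVec {Ω : Type*} [MeasurableSpace Ω] {p : ℕ} (μ : Measure Ω) (V : Ω → Fin p → ℝ) :
    ℝ≥0∞ :=
  ⨆ (x : Fin p → ℝ) (_ : ∑ k, x k ^ 2 = 1), psi2Norm μ fun ω => V ω ⬝ᵥ x

/-- `f_n = O_P(r_n)` for random variables `f_n` that live on probability spaces varying with `n`. -/
def IsBigOP {Ω : ℕ → Type*} [∀ n, MeasurableSpace (Ω n)] (P : ∀ n, Measure (Ω n))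
    (f : ∀ n, Ω n → ℝ) (r : ℕ → ℝ) : Prop :=
  ∀ η : ℝ, 0 < η → ∃ M : ℝ, 0 < M ∧
    ∀ᶠ n in atTop, P n {ω | M * r n < |f n ω|} ≤ ENNReal.ofReal η

/-- `f_n = o_P(r_n)` for random variables `f_n` that live on probability spaces varying with `n`. -/
def IsLittleOP {Ω : ℕ → Type*} [∀ n, MeasurableSpace (Ω n)] (P : ∀ n, Measure (Ω n))
    (f : ∀ n, Ω n → ℝ) (r : ℕ → ℝ) : Prop :=
  ∀ c : ℝ, 0 < c → Tendsto (fun n => P n {ω | c * r n < |f n ω|}) atTop (𝓝 0)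

/-- The law `Π_W` of the Bayesian bootstrap weights `W_{ni} = ω_i / ∑ ω_j`, where the `ω_j` are
i.i.d. standard exponential. -/
def bootstrapLaw (n : ℕ) : Measure (Fin n → ℝ) :=
  (Measure.pi fun _ : Fin n => expMeasure 1).map fun ω i => ω i / ∑ j, ω j

/-- The debiased draw `b + Θ̂ [∑ w_i X_i (Y_i - X_iᵀ b)]`. -/
def debias {n p : ℕ} (Θ : Matrix (Fin p) (Fin p) ℝ) (z : Sample n p) (b : Fin p → ℝ)
    (w : Fin n → ℝ) : Fin p → ℝ :=
  b + Θ *ᵥ ∑ i, (w i * ((z i).1 - (z i).2 ⬝ᵥ b)) • (z i).2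

/-- The debiased posterior: the law of `β̃` given the data `z` when `(β, W) ∼ Π_β(· | z) × Π_W`. -/
def debiasedPosterior {n p : ℕ} (Post : Kernel (Sample n p) (Fin p → ℝ))
    (Θhat : Sample n p → Matrix (Fin p) (Fin p) ℝ) (z : Sample n p) : Measure (Fin p → ℝ) :=
  ((Post z).prod (bootstrapLaw n)).map fun bw => debias (Θhat z) z bw.1 bw.2

/-- The `τ`-quantile `inf {x : ν (-∞, x] ≥ τ}` of a law `ν` on the line. -/
def quantile (ν : Measure ℝ) (τ : ℝ) : ℝ := sInf {x : ℝ | τ ≤ ν.real (Set.Iic x)}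

/-- The `τ`-quantile `q_{n,j}(τ)` of the `j`th coordinate of the debiased posterior. -/
def posteriorQuantile {n p : ℕ} (Post : Kernel (Sample n p) (Fin p → ℝ))
    (Θhat : Sample n p → Matrix (Fin p) (Fin p) ℝ) (z : Sample n p) (j : Fin p) (τ : ℝ) : ℝ :=
  quantile ((debiasedPosterior Post Θhat z).map fun b => b j) τ

/-- The credible interval `[q_{n,j}(α/2), q_{n,j}(1 - α/2)]`. -/
def credibleInterval {n p : ℕ} (Post : Kernel (Sample n p) (Fin p → ℝ))
    (Θhat : Sample n p → Matrix (Fin p) (Fin p) ℝ) (z : Sample n p) (j : Fin p) (α : ℝ) : Set ℝ :=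
  Set.Icc (posteriorQuantile Post Θhat z j (α / 2)) (posteriorQuantile Post Θhat z j (1 - α / 2))

/-- The remainder `Δ_n = β̂_n - β₀ - Θ₀ n⁻¹ ∑ X_i ε_i` in the expansion of a point estimate. -/
def expansionRemainder {n p : ℕ} (μ : Measure (Obs p)) (β₀ bhat : Fin p → ℝ) (z : Sample n p) :
    Fin p → ℝ :=
  bhat - β₀ - Theta0 μ *ᵥ ((n : ℝ)⁻¹ • ∑ i, err β₀ (z i) • (z i).2)

end DebiasedBayes

end

open DebiasedBayes

/-! An equal-tailed interval covers the true coordinate when the posterior distribution function,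
evaluated at that coordinate, lies between α/2 and 1 - α/2. The proof shows that this random value
is asymptotically uniform.

Multiplying the error of a debiased draw by the positive number n⁻¹ ∑ ω_i keeps its sign and turns
the normalized weights into independent exponentials. By `debias_expansion` the product is n⁻¹ ∑ ω_i
ξ_i plus a remainder, where ξ_i = e_jᵀ Θ₀ X_i ε_i. Debiasing leaves the initial error β - β₀ only in
products with small factors: the mean of the weights minus one, Θ̂ Ω̂ - I, and the weight noise n⁻¹
∑ (ω_i - 1) X_i X_iᵀ. A last term pairs Θ̂ - Θ₀ with the weighted score. `exists_noise_bound`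
controls noise and score by Bernstein inequalities and union bounds, and the rate conditions then
make √n times the remainder vanish (`eventually_remainder_lt`).

Put V = -∑ ξ_i / (σ √n) and T = ∑ ξ_i (ω_i - 1) / (σ √n). Up to a small shift, the posterior
probability of falling below the truth is the conditional probability of T ≤ V
(`coordLaw_cdf_compare`). Given the data, T is nearly standard normal with high probability
(`eventually_bootstrap_sum_cdf_close`), so this probability is close to Φ(V). Over the data V is
nearly standard normal too (`eventually_normalized_sum_cdf_close`), so Φ(V) is nearly uniform.

Both limits come from one central limit theorem, uniform over laws and weights, as a triangular
array demands. Coverage is then sandwiched between events about V (`mem_Icc_quantile_of_cdf_bounds`,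
`abs_measureReal_sub_le_of_sandwich`). -/

namespace DebiasedBayes

/-! ### A Lyapunov central limit theorem for weighted sums -/

lemma norm_cexp_sub_taylor_two_le (y : ℝ) :
    ‖Complex.exp (y * Complex.I) - (1 + y * Complex.I - y ^ 2 / 2)‖ ≤ 4 * |y| ^ 3 := by
  rcases le_total |y| 1 with h | h
  · have hn : ‖(y * Complex.I : ℂ)‖ = |y| := by simp
    have := Complex.exp_bound (x := y * Complex.I) (by rw [hn]; exact h) (n := 3) (by norm_num)
    rw [hn] at this
    have he : ∑ m ∈ Finset.range 3, (y * Complex.I : ℂ) ^ m / (m.factorial : ℂ)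
        = 1 + y * Complex.I - y ^ 2 / 2 := by
      simp [Finset.sum_range_succ, mul_pow, Nat.factorial]
      ring
    rw [he] at this
    refine this.trans ?_
    have : 0 ≤ |y| ^ 3 := by positivity
    norm_num [Nat.factorial]
    linarith
  · have h1 : ‖Complex.exp (y * Complex.I)‖ = 1 := Complex.norm_exp_ofReal_mul_I y
    have h2 : ‖(1 + y * Complex.I - y ^ 2 / 2 : ℂ)‖ ≤ 1 + |y| + |y| ^ 2 / 2 := by
      refine (norm_sub_le _ _).trans (add_le_add ((norm_add_le _ _).trans ?_) ?_)
      · simp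
      · simp
    refine (norm_sub_le _ _).trans ?_
    rw [h1]
    have h3 : |y| ≤ |y| ^ 3 := le_self_pow₀ h (by norm_num)
    have h4 : |y| ^ 2 ≤ |y| ^ 3 := pow_le_pow_right₀ h (by norm_num)
    nlinarith

lemma abs_exp_neg_sub_taylor_le (y : ℝ) :
    |Real.exp (-(y ^ 2 / 2)) - (1 - y ^ 2 / 2)| ≤ |y| ^ 3 := by
  have h0 : 1 - y ^ 2 / 2 ≤ Real.exp (-(y ^ 2 / 2)) := by
    have := Real.add_one_le_exp (-(y ^ 2 / 2)); linarith
  rw [abs_of_nonneg (by linarith)]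
  have hy2 : y ^ 2 = |y| ^ 2 := (sq_abs y).symm
  rw [hy2] at *
  have ha := abs_nonneg y
  set u := |y|
  rcases le_total u 1 with h | h
  · have := Real.abs_exp_sub_one_sub_id_le (x := -(u ^ 2 / 2))
      (by rw [abs_neg, abs_of_nonneg (by positivity)]; nlinarith)
    have h2 := (abs_le.mp this).2
    nlinarith [pow_nonneg ha 3]
  · have : Real.exp (-(u ^ 2 / 2)) ≤ 1 := Real.exp_le_one_iff.2 (by nlinarith [sq_nonneg u])
    have h4 : u ^ 2 ≤ u ^ 3 := pow_le_pow_right₀ h (by norm_num)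
    nlinarith [sq_nonneg u]

/-- Factors are exchanged one at a time, the untouched ones having modulus at most one. -/
lemma norm_prod_sub_prod_le_sum {ι : Type*} (s : Finset ι) (f g : ι → ℂ)
    (hf : ∀ i, ‖f i‖ ≤ 1) (hg : ∀ i, ‖g i‖ ≤ 1) :
    ‖∏ i ∈ s, f i - ∏ i ∈ s, g i‖ ≤ ∑ i ∈ s, ‖f i - g i‖ := by
  classical
  induction s using Finset.induction_on with
  | empty => simp
  | insert i s his ih =>
    rw [Finset.prod_insert his, Finset.prod_insert his, Finset.sum_insert his]
    have hp : ‖∏ i ∈ s, f i‖ ≤ 1 := by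
      rw [norm_prod]
      exact Finset.prod_le_one (fun _ _ => norm_nonneg _) fun i _ => hf i
    have : f i * ∏ i ∈ s, f i - g i * ∏ i ∈ s, g i
        = (f i - g i) * ∏ i ∈ s, f i + g i * (∏ i ∈ s, f i - ∏ i ∈ s, g i) := by ring
    rw [this]
    refine (norm_add_le _ _).trans (add_le_add ?_ ?_)
    · rw [norm_mul]
      exact mul_le_of_le_one_right (norm_nonneg _) hp
    · rw [norm_mul]
      exact (mul_le_of_le_one_left (norm_nonneg _) (hg i)).trans ih

lemma norm_integral_cexp_sub_le {E : Type*} [MeasurableSpace E] (ν : Measure E)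
    [IsProbabilityMeasure ν] {D : E → ℝ} (hD : Measurable D)
    (h3 : Integrable (fun x => |D x| ^ 3) ν) (h1 : ∫ x, D x ∂ν = 0)
    (h2 : ∫ x, D x ^ 2 ∂ν = 1) (y : ℝ) :
    ‖∫ x, Complex.exp ((y * D x : ℝ) * Complex.I) ∂ν - (Real.exp (-(y ^ 2 / 2)) : ℝ)‖
      ≤ (4 * ∫ x, |D x| ^ 3 ∂ν + 1) * |y| ^ 3 := by
  have i1 : Integrable D ν := by
    refine (h3.add (integrable_const (1 : ℝ))).mono' hD.aestronglyMeasurable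
      (ae_of_all _ fun x => ?_)
    simp only [Pi.add_apply, Real.norm_eq_abs]
    rcases le_total |D x| 1 with h | h
    · have := pow_nonneg (abs_nonneg (D x)) 3; linarith
    · have := le_self_pow₀ h (n := 3) (by norm_num); linarith
  have i2 : Integrable (fun x => D x ^ 2) ν := by
    refine (h3.add (integrable_const (1 : ℝ))).mono' (hD.pow_const 2).aestronglyMeasurable
      (ae_of_all _ fun x => ?_)
    simp only [Pi.add_apply, Real.norm_eq_abs, abs_pow]
    rcases le_total |D x| 1 with h | h
    · have := pow_nonneg (abs_nonneg (D x)) 3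
      have := pow_le_one₀ (abs_nonneg (D x)) h (n := 2); linarith
    · have := pow_le_pow_right₀ h (show 2 ≤ 3 by norm_num); linarith
  have iE : Integrable (fun x => Complex.exp ((y * D x : ℝ) * Complex.I)) ν := by
    refine (integrable_const (1 : ℝ)).mono' ?_ (ae_of_all _ fun x => ?_)
    · exact (by fun_prop : Measurable fun x =>
        Complex.exp ((y * D x : ℝ) * Complex.I)).aestronglyMeasurable
    · rw [Complex.norm_exp_ofReal_mul_I]
  have iT : Integrable (fun x => (1 + (y * D x : ℝ) * Complex.I - ((y * D x : ℝ) : ℂ) ^ 2 / 2)) ν := by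
    refine ((integrable_const (1 : ℂ)).add ((i1.const_mul y).ofReal.mul_const _)).sub ?_
    have : Integrable (fun x => (((y ^ 2 / 2) * D x ^ 2 : ℝ) : ℂ)) ν := (i2.const_mul _).ofReal
    refine this.congr (ae_of_all _ fun x => ?_)
    push_cast; ring
  have eT : ∫ x, (1 + (y * D x : ℝ) * Complex.I - ((y * D x : ℝ) : ℂ) ^ 2 / 2) ∂ν
      = ((1 - y ^ 2 / 2 : ℝ) : ℂ) := by
    have e2 : ∀ x, (((y * D x : ℝ) : ℂ) ^ 2 / 2) = (((y ^ 2 / 2) * D x ^ 2 : ℝ) : ℂ) := by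
      intro x; push_cast; ring
    simp_rw [e2]
    have iA : Integrable (fun x => (1 : ℂ) + (y * D x : ℝ) * Complex.I) ν :=
      (integrable_const (1 : ℂ)).add ((i1.const_mul y).ofReal.mul_const _)
    have iC : Integrable (fun x => ((y * D x : ℝ) : ℂ) * Complex.I) ν :=
      (i1.const_mul y).ofReal.mul_const _
    have iB : Integrable (fun x => ((y ^ 2 / 2 * D x ^ 2 : ℝ) : ℂ)) ν := (i2.const_mul _).ofReal
    rw [integral_sub iA iB, integral_add (integrable_const (1 : ℂ)) iC, integral_mul_const,
      integral_complex_ofReal, integral_complex_ofReal,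
      integral_const_mul, integral_const_mul, h1, h2]
    simp
  have hA : ‖∫ x, Complex.exp ((y * D x : ℝ) * Complex.I) ∂ν - ((1 - y ^ 2 / 2 : ℝ) : ℂ)‖
      ≤ 4 * (∫ x, |D x| ^ 3 ∂ν) * |y| ^ 3 := by
    rw [← eT, ← integral_sub iE iT]
    refine (norm_integral_le_of_norm_le (h3.const_mul (4 * |y| ^ 3)) (ae_of_all _ fun x => ?_)).trans ?_
    · refine (norm_cexp_sub_taylor_two_le (y * D x)).trans (le_of_eq ?_)
      rw [abs_mul]; ring
    · rw [integral_const_mul]; exact le_of_eq (by ring)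
  have hB : ‖((1 - y ^ 2 / 2 : ℝ) : ℂ) - (Real.exp (-(y ^ 2 / 2)) : ℝ)‖ ≤ |y| ^ 3 := by
    rw [← Complex.ofReal_sub, Complex.norm_real, Real.norm_eq_abs, abs_sub_comm]
    exact abs_exp_neg_sub_taylor_le y
  calc _ ≤ _ := norm_sub_le_norm_sub_add_norm_sub _ ((1 - y ^ 2 / 2 : ℝ) : ℂ) _
    _ ≤ _ := add_le_add hA hB
    _ = _ := by ring

lemma charFun_map_weighted_sum {E : Type*} [MeasurableSpace E] (ν : Measure E)
    [IsProbabilityMeasure ν] {D : E → ℝ} (hD : Measurable D) {n : ℕ} (a : Fin n → ℝ) (t : ℝ) :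
    charFun ((Measure.pi fun _ : Fin n => ν).map fun x => ∑ i, a i * D (x i)) t
      = ∏ i, ∫ x, Complex.exp ((t * a i * D x : ℝ) * Complex.I) ∂ν := by
  have hm : Measurable fun x : Fin n → E => ∑ i, a i * D (x i) := by fun_prop
  rw [charFun_apply_real, integral_map hm.aemeasurable (by fun_prop),
    ← integral_fintype_prod_eq_prod (fun i x => Complex.exp ((t * a i * D x : ℝ) * Complex.I))]
  congr 1
  ext x
  rw [← Complex.exp_sum]
  congr 1
  push_cast
  rw [Finset.mul_sum, Finset.sum_mul]
  exact Finset.sum_congr rfl fun i _ => by ring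

/-- Two replacements: each factor by the Gaussian one with the same variance, at the cost of third
moments, and then the total variance ∑ a_i² by 1. Explicit errors make the bound uniform in the law,
in n and in the weights. -/
lemma norm_charFun_weighted_sum_sub_le {E : Type*} [MeasurableSpace E] (ν : Measure E)
    [IsProbabilityMeasure ν] {D : E → ℝ} (hD : Measurable D)
    (h3 : Integrable (fun x => |D x| ^ 3) ν) (h1 : ∫ x, D x ∂ν = 0)
    (h2 : ∫ x, D x ^ 2 ∂ν = 1) {n : ℕ} (a : Fin n → ℝ) (t : ℝ) :
    ‖charFun ((Measure.pi fun _ : Fin n => ν).map fun x => ∑ i, a i * D (x i)) t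
        - (Real.exp (-(t ^ 2 / 2)) : ℝ)‖
      ≤ (4 * ∫ x, |D x| ^ 3 ∂ν + 1) * (∑ i, |a i| ^ 3) * |t| ^ 3 + |∑ i, a i ^ 2 - 1| * t ^ 2 := by
  rw [charFun_map_weighted_sum ν hD]
  have hA : ‖∏ i, ∫ x, Complex.exp ((t * a i * D x : ℝ) * Complex.I) ∂ν
      - ∏ i, ((Real.exp (-((t * a i) ^ 2 / 2)) : ℝ) : ℂ)‖
      ≤ (4 * ∫ x, |D x| ^ 3 ∂ν + 1) * (∑ i, |a i| ^ 3) * |t| ^ 3 := by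
    refine (norm_prod_sub_prod_le_sum _ _ _ (fun i => ?_) fun i => ?_).trans ?_
    · refine (norm_integral_le_of_norm_le (integrable_const (1 : ℝ))
        (ae_of_all _ fun x => ?_)).trans (by simp)
      rw [Complex.norm_exp_ofReal_mul_I]
    · rw [Complex.norm_real, Real.norm_eq_abs, Real.abs_exp, Real.exp_le_one_iff]
      nlinarith [sq_nonneg (t * a i)]
    · rw [Finset.mul_sum, Finset.sum_mul]
      refine Finset.sum_le_sum fun i _ => ?_
      refine (norm_integral_cexp_sub_le ν hD h3 h1 h2 (t * a i)).trans (le_of_eq ?_)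
      rw [abs_mul]; ring
  have hB : ‖∏ i, ((Real.exp (-((t * a i) ^ 2 / 2)) : ℝ) : ℂ) - (Real.exp (-(t ^ 2 / 2)) : ℝ)‖
      ≤ |∑ i, a i ^ 2 - 1| * t ^ 2 := by
    rw [← Complex.ofReal_prod, ← Complex.ofReal_sub, Complex.norm_real, Real.norm_eq_abs,
      ← Real.exp_sum]
    have e : ∑ i, -((t * a i) ^ 2 / 2) = -((∑ i, a i ^ 2) * t ^ 2 / 2) := by
      rw [Finset.sum_neg_distrib, Finset.sum_mul, Finset.sum_div]
      exact congrArg _ (Finset.sum_congr rfl fun i _ => by ring)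
    rw [e]
    have key : ∀ u v : ℝ, 0 ≤ u → 0 ≤ v → |Real.exp (-u) - Real.exp (-v)| ≤ |u - v| := by
      have : ∀ u v : ℝ, 0 ≤ u → u ≤ v → |Real.exp (-u) - Real.exp (-v)| ≤ |u - v| := by
        intro u v hu huv
        have h1 : Real.exp (-v) ≤ Real.exp (-u) := Real.exp_le_exp.2 (by linarith)
        rw [abs_of_nonneg (by linarith), abs_sub_comm, abs_of_nonneg (by linarith)]
        have h2 : Real.exp (-v) = Real.exp (-u) * Real.exp (-(v - u)) := by
          rw [← Real.exp_add]; ring_nf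
        have h3 := Real.add_one_le_exp (-(v - u))
        have h4 : Real.exp (-u) ≤ 1 := Real.exp_le_one_iff.2 (by linarith)
        have h5 := Real.exp_pos (-u)
        rw [h2]
        nlinarith
      intro u v hu hv
      rcases le_total u v with h | h
      · exact this u v hu h
      · rw [abs_sub_comm, abs_sub_comm u]; exact this v u hv h
    refine (key _ _ (by positivity) (by positivity)).trans ?_
    have : (∑ i, a i ^ 2) * t ^ 2 / 2 - t ^ 2 / 2 = (∑ i, a i ^ 2 - 1) * (t ^ 2 / 2) := by ring
    rw [this, abs_mul, abs_of_nonneg (by positivity : (0 : ℝ) ≤ t ^ 2 / 2)]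
    exact mul_le_mul_of_nonneg_left (by nlinarith [sq_nonneg t]) (abs_nonneg _)
  exact (norm_sub_le_norm_sub_add_norm_sub _ _ _).trans (add_le_add hA hB)

/-- Closeness of characteristic functions to the one of the standard normal law forces closeness
of the distribution functions at any given point. -/
lemma exists_charFun_bound_imp_cdf_close (x : ℝ) {κ : ℝ} (hκ : 0 < κ) :
    ∃ δ : ℝ, 0 < δ ∧ ∀ ν : Measure ℝ, IsProbabilityMeasure ν →
      (∀ t : ℝ, ‖charFun ν t - (Real.exp (-(t ^ 2 / 2)) : ℝ)‖ ≤ δ * (|t| ^ 3 + t ^ 2)) →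
      |ν.real (Set.Iic x) - (gaussianReal 0 1).real (Set.Iic x)| ≤ κ := by
  -- If no δ worked, laws violating the conclusion with δ = 1 / (m + 1) would converge weakly to the
  -- normal law by Lévy's continuity theorem. The portmanteau theorem at the non-atom x then
  -- contradicts their failure.
  by_contra! hcon
  choose ν hν hcf hbad using fun m : ℕ => hcon (1 / ((m : ℝ) + 1)) (by positivity)
  let P : ℕ → ProbabilityMeasure ℝ := fun m => ⟨ν m, hν m⟩
  let G : ProbabilityMeasure ℝ := ⟨gaussianReal 0 1, inferInstance⟩
  have hlim : Tendsto P atTop (𝓝 G) := by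
    refine ProbabilityMeasure.tendsto_of_tendsto_charFun fun t => ?_
    have hG : charFun (G : Measure ℝ) t = (Real.exp (-(t ^ 2 / 2)) : ℝ) := by
      change charFun (gaussianReal 0 1) t = _
      rw [charFun_gaussianReal]
      push_cast
      congr 1
      simp
    rw [hG, tendsto_iff_norm_sub_tendsto_zero]
    refine squeeze_zero (fun _ => norm_nonneg _) (fun m => hcf m t) ?_
    simpa using (tendsto_one_div_add_atTop_nhds_zero_nat (𝕜 := ℝ)).mul_const (|t| ^ 3 + t ^ 2)
  have hfr : G (frontier (Set.Iic x)) = 0 := by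
    rw [frontier_Iic]
    have := nullSingletonClass_gaussianReal (μ := 0) (v := 1) one_ne_zero
    have h0 : gaussianReal 0 1 {x} = 0 := measure_singleton x
    change (gaussianReal 0 1 {x}).toNNReal = 0
    rw [h0, ENNReal.toNNReal_zero]
  have ht := ProbabilityMeasure.tendsto_measure_of_null_frontier_of_tendsto hlim hfr
  have ht' : Tendsto (fun m => (ν m).real (Set.Iic x)) atTop
      (𝓝 ((gaussianReal 0 1).real (Set.Iic x))) :=
    (NNReal.tendsto_coe.2 ht)
  obtain ⟨m, hm⟩ := (Metric.tendsto_nhds.1 ht' κ hκ).exists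
  rw [Real.dist_eq] at hm
  exact absurd (hbad m) (not_lt.2 hm.le)

/-- A Lyapunov central limit theorem for weighted sums of i.i.d. variables, in terms of the
Lyapunov ratio and uniformly over laws and weights. -/
lemma exists_lyapunov_imp_cdf_close (x : ℝ) {κ : ℝ} (hκ : 0 < κ) :
    ∃ δ : ℝ, 0 < δ ∧ ∀ {E : Type} [MeasurableSpace E] (ν : Measure E) [IsProbabilityMeasure ν]
      (D : E → ℝ), Measurable D → Integrable (fun x => |D x| ^ 3) ν → ∫ x, D x ∂ν = 0 →
      ∫ x, D x ^ 2 ∂ν = 1 → ∀ (n : ℕ) (a : Fin n → ℝ), |∑ i, a i ^ 2 - 1| ≤ δ →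
      (4 * ∫ x, |D x| ^ 3 ∂ν + 1) * (∑ i, |a i| ^ 3) ≤ δ →
      |(Measure.pi fun _ : Fin n => ν).real {ω | ∑ i, a i * D (ω i) ≤ x}
        - (gaussianReal 0 1).real (Set.Iic x)| ≤ κ := by
  obtain ⟨δ, hδ, h⟩ := exists_charFun_bound_imp_cdf_close x hκ
  refine ⟨δ, hδ, fun ν _ D hD h3 h1 h2 n a ha2 ha3 => ?_⟩
  have hm : Measurable fun ω : Fin n → _ => ∑ i, a i * D (ω i) := by fun_prop
  have := h ((Measure.pi fun _ : Fin n => ν).map fun ω => ∑ i, a i * D (ω i))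
    (Measure.isProbabilityMeasure_map hm.aemeasurable) fun t => ?_
  · rwa [map_measureReal_apply hm measurableSet_Iic] at this
  · refine (norm_charFun_weighted_sum_sub_le ν hD h3 h1 h2 a t).trans ?_
    rw [mul_add]
    exact add_le_add (mul_le_mul_of_nonneg_right ha3 (by positivity))
      (mul_le_mul_of_nonneg_right ha2 (by positivity))

/-! ### Bernstein-type inequalities -/

lemma exp_le_one_add_add_sq_mul_exp_abs (y : ℝ) :
    Real.exp y ≤ 1 + y + y ^ 2 * Real.exp |y| := by
  have h := Complex.norm_exp_sub_sum_le_norm_mul_exp (y : ℂ) 2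
  have e : Complex.exp (y : ℂ) - ∑ m ∈ Finset.range 2, (y : ℂ) ^ m / (m.factorial : ℂ)
      = ((Real.exp y - (1 + y) : ℝ) : ℂ) := by
    simp [Finset.sum_range_succ]
  rw [e, Complex.norm_real, Complex.norm_real, Real.norm_eq_abs, Real.norm_eq_abs, sq_abs] at h
  linarith [(abs_le.1 h).2]

section Bernstein

variable {E : Type*} [MeasurableSpace E] {ν : Measure E} {D : E → ℝ}

lemma integrable_exp_mul_of_integrable_exp_abs (hD : Measurable D)
    (hψ : Integrable (fun x => Real.exp |D x|) ν) {r : ℝ} (hr : |r| ≤ 1) :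
    Integrable (fun x => Real.exp (r * D x)) ν := by
  refine hψ.mono' (by fun_prop) (ae_of_all _ fun x => ?_)
  rw [Real.norm_eq_abs, Real.abs_exp]
  refine Real.exp_le_exp.2 ((le_abs_self _).trans ?_)
  rw [abs_mul]
  exact mul_le_of_le_one_left (abs_nonneg _) hr

lemma integrable_of_integrable_exp_abs (hD : Measurable D)
    (hψ : Integrable (fun x => Real.exp |D x|) ν) : Integrable D ν := by
  refine hψ.mono' hD.aestronglyMeasurable (ae_of_all _ fun x => ?_)
  rw [Real.norm_eq_abs]
  linarith [Real.add_one_le_exp |D x|]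

lemma measureReal_ge_le_two_mul_exp {f : E → ℝ}
    (hψ : Integrable (fun x => Real.exp (f x)) ν) (hψ2 : ∫ x, Real.exp (f x) ∂ν ≤ 2) (t : ℝ) :
    ν.real {x | t ≤ f x} ≤ 2 * Real.exp (-t) := by
  have h := mul_meas_ge_le_integral_of_nonneg (ae_of_all _ fun x => (Real.exp_pos (f x)).le) hψ
    (Real.exp t)
  simp only [Real.exp_le_exp] at h
  rw [Real.exp_neg, ← div_eq_mul_inv, le_div_iff₀ (Real.exp_pos t)]
  linarith

variable [IsProbabilityMeasure ν]

/-- Half of the exponential moment absorbs D² ≤ 8 exp (|D| / 2), the other half absorbs exp |r D|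
because |r| ≤ 1/2. The linear term vanishes by centring, which leaves 8 r² times the moment bound 2.
-/
lemma mgf_le_of_integral_exp_abs_le (hD : Measurable D)
    (hψ : Integrable (fun x => Real.exp |D x|) ν) (hψ2 : ∫ x, Real.exp |D x| ∂ν ≤ 2)
    (h0 : ∫ x, D x ∂ν = 0) {r : ℝ} (hr : |r| ≤ 1 / 2) :
    mgf D ν r ≤ Real.exp (16 * r ^ 2) := by
  have hpt : ∀ x, Real.exp (r * D x) ≤ 1 + r * D x + 8 * r ^ 2 * Real.exp |D x| := by
    intro x
    refine (exp_le_one_add_add_sq_mul_exp_abs _).trans ?_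
    have h1 : |r * D x| ≤ |D x| / 2 := by
      rw [abs_mul]
      nlinarith [abs_nonneg (D x)]
    have h2 : (|D x| / 2) ^ 2 / 2 ≤ Real.exp (|D x| / 2) := by
      have := Real.pow_div_factorial_le_exp (|D x| / 2) (by positivity) 2
      simpa using this
    have h3 : Real.exp |D x| = Real.exp (|D x| / 2) * Real.exp (|D x| / 2) := by
      rw [← Real.exp_add]; ring_nf
    have h4 : (r * D x) ^ 2 * Real.exp |r * D x| ≤ (r ^ 2 * (8 * Real.exp (|D x| / 2)))
        * Real.exp (|D x| / 2) := by
      gcongr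
      rw [mul_pow]
      gcongr
      rw [← sq_abs (D x)]
      linarith
    rw [h3]
    linarith
  have hi : Integrable (fun x => 1 + r * D x + 8 * r ^ 2 * Real.exp |D x|) ν :=
    (((integrable_const _).add ((integrable_of_integrable_exp_abs hD hψ).const_mul r)).add
      (hψ.const_mul _))
  have i1 : Integrable (fun x => 1 + r * D x) ν :=
    (integrable_const _).add ((integrable_of_integrable_exp_abs hD hψ).const_mul r)
  have hint := integral_mono
    (integrable_exp_mul_of_integrable_exp_abs hD hψ (hr.trans (by norm_num))) hi hpt
  rw [integral_add i1 (hψ.const_mul _), integral_add (integrable_const _)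
    ((integrable_of_integrable_exp_abs hD hψ).const_mul r), integral_const_mul,
    integral_const_mul, h0] at hint
  simp only [integral_const, probReal_univ, smul_eq_mul, mul_one, mul_zero, add_zero] at hint
  have := Real.add_one_le_exp (16 * r ^ 2)
  unfold mgf
  nlinarith [sq_nonneg r]

lemma pi_measureReal_ge_le_exp_mul_prod_mgf {n : ℕ} (f : Fin n → E → ℝ)
    {r : ℝ} (hr : 0 ≤ r)
    (hint : ∀ i, Integrable (fun x => Real.exp (r * f i x)) ν) (c : ℝ) :
    (Measure.pi fun _ : Fin n => ν).real {ω | c ≤ ∑ i, f i (ω i)}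
      ≤ Real.exp (-r * c) * ∏ i, mgf (f i) ν r := by
  have e : ∀ ω : Fin n → E, Real.exp (r * ∑ i, f i (ω i)) = ∏ i, Real.exp (r * f i (ω i)) := by
    intro ω
    rw [← Real.exp_sum, Finset.mul_sum]
  refine (measure_ge_le_exp_mul_mgf (X := fun ω : Fin n → E => ∑ i, f i (ω i)) c hr ?_).trans
    (le_of_eq ?_)
  · simp_rw [e]
    exact Integrable.fintype_prod (f := fun i x => Real.exp (r * f i x)) hint
  · congr 1
    unfold mgf
    simp_rw [e]
    exact integral_fintype_prod_eq_prod (fun i x => Real.exp (r * f i x))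

lemma pi_measureReal_weighted_sum_ge_le (hD : Measurable D)
    (hψ : Integrable (fun x => Real.exp |D x|) ν) (hψ2 : ∫ x, Real.exp |D x| ∂ν ≤ 2)
    (h0 : ∫ x, D x ∂ν = 0) {n : ℕ} (a : Fin n → ℝ) {v B t : ℝ} (hv : 0 < v) (hB : 0 < B)
    (ht : 0 ≤ t) (hav : ∑ i, a i ^ 2 ≤ v) (haB : ∀ i, |a i| ≤ B) :
    (Measure.pi fun _ : Fin n => ν).real {ω | 8 * √(v * t) + 4 * B * t ≤ ∑ i, a i * D (ω i)}
      ≤ Real.exp (-t) := by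
  have key : ∀ r : ℝ, 0 ≤ r → r * B ≤ 1 / 2 →
      -r * (8 * √(v * t) + 4 * B * t) + 16 * r ^ 2 * v ≤ -t →
      (Measure.pi fun _ : Fin n => ν).real {ω | 8 * √(v * t) + 4 * B * t ≤ ∑ i, a i * D (ω i)}
      ≤ Real.exp (-t) := by
    intro r hr hrB hle
    have hra : ∀ i, |r * a i| ≤ 1 / 2 := fun i => by
      rw [abs_mul, abs_of_nonneg hr]
      exact (mul_le_mul_of_nonneg_left (haB i) hr).trans hrB
    have hmgf : ∀ i, mgf (fun x => a i * D x) ν r ≤ Real.exp (16 * (r * a i) ^ 2) := fun i => by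
      have : mgf (fun x => a i * D x) ν r = mgf D ν (r * a i) := by
        unfold mgf
        simp only [mul_assoc]
      rw [this]
      exact mgf_le_of_integral_exp_abs_le hD hψ hψ2 h0 (hra i)
    refine (pi_measureReal_ge_le_exp_mul_prod_mgf (fun i x => a i * D x)
 hr (fun i => ?_) _).trans ?_
    · simp_rw [← mul_assoc]
      exact integrable_exp_mul_of_integrable_exp_abs hD hψ ((hra i).trans (by norm_num))
    · calc _ ≤ Real.exp (-r * (8 * √(v * t) + 4 * B * t)) * ∏ i, Real.exp (16 * (r * a i) ^ 2) := by
            gcongr with i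
            · exact fun i _ => mgf_nonneg
            · exact hmgf i
        _ = Real.exp (-r * (8 * √(v * t) + 4 * B * t) + 16 * r ^ 2 * ∑ i, a i ^ 2) := by
            rw [← Real.exp_sum, ← Real.exp_add, Finset.mul_sum]
            congr 2
            exact Finset.sum_congr rfl fun i _ => by ring
        _ ≤ _ := by
            refine Real.exp_le_exp.2 (le_trans ?_ hle)
            gcongr
  have hs : √(v * t) ^ 2 = v * t := Real.sq_sqrt (by positivity)
  have hs0 := Real.sqrt_nonneg (v * t)
  set q := √(v * t) with hq
  -- The exponent -8 r q + 16 r² v is minimized at r = q / (4 v). If that exceeds the range r B ≤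
  -- 1/2 of the moment bound, the endpoint r = 1 / (2 B) is used and the linear term 4 B t pays.
  rcases le_total (q / (4 * v) * B) (1 / 2) with h | h
  · refine key (q / (4 * v)) (by positivity) h ?_
    have e1 : q / (4 * v) * (8 * q) = 2 * t := by
      field_simp
      nlinarith
    have e2 : 16 * (q / (4 * v)) ^ 2 * v = t := by
      field_simp
      nlinarith
    have e3 : 0 ≤ q / (4 * v) * (4 * B * t) := by positivity
    linarith
  · refine key (1 / (2 * B)) (by positivity) (by field_simp; norm_num) ?_
    have e1 : 1 / (2 * B) * (4 * B * t) = 2 * t := by field_simp; norm_num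
    have e2 : 16 * (1 / (2 * B)) ^ 2 * v ≤ 1 / (2 * B) * (8 * q) := by
      have h2 : 2 * v ≤ q * B := by
        rw [div_mul_eq_mul_div, le_div_iff₀ (by positivity)] at h
        linarith
      have : 1 / (2 * B) * (8 * q) - 16 * (1 / (2 * B)) ^ 2 * v = 4 * (q * B - v) / B ^ 2 := by
        field_simp; ring
      have h3 : 0 ≤ 4 * (q * B - v) / B ^ 2 := by
        apply div_nonneg <;> nlinarith
      linarith
    linarith

/-- Bernstein's inequality for weighted sums of i.i.d. centred sub-exponential variables. -/
lemma pi_measureReal_abs_weighted_sum_ge_le (hD : Measurable D)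
    (hψ : Integrable (fun x => Real.exp |D x|) ν) (hψ2 : ∫ x, Real.exp |D x| ∂ν ≤ 2)
    (h0 : ∫ x, D x ∂ν = 0) {n : ℕ} (a : Fin n → ℝ) {v B t : ℝ} (hv : 0 < v) (hB : 0 < B)
    (ht : 0 ≤ t) (hav : ∑ i, a i ^ 2 ≤ v) (haB : ∀ i, |a i| ≤ B) :
    (Measure.pi fun _ : Fin n => ν).real {ω | 8 * √(v * t) + 4 * B * t ≤ |∑ i, a i * D (ω i)|}
      ≤ 2 * Real.exp (-t) := by
  have h1 := pi_measureReal_weighted_sum_ge_le hD hψ hψ2 h0 a hv hB ht hav haB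
  have h2 := pi_measureReal_weighted_sum_ge_le hD hψ hψ2 h0 (fun i => -a i) hv hB ht
    (by simpa using hav) (by simpa using haB)
  refine (measureReal_mono (fun ω hω => ?_)).trans
    ((measureReal_union_le _ _).trans ((add_le_add h1 h2).trans (by linarith)))
  rw [Set.mem_ofPred_eq] at hω
  rcases le_abs.1 hω with h | h
  · exact Or.inl h
  · refine Or.inr ?_
    simpa [Finset.sum_neg_distrib] using h

/-- A multiplicative Chernoff bound for sums of i.i.d. nonnegative bounded variables. -/
lemma pi_measureReal_sum_ge_le {f : E → ℝ} (hf : Measurable f) {b m t : ℝ} (hb : 0 < b)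
    (hf0 : ∀ x, 0 ≤ f x) (hfb : ∀ x, f x ≤ b) (hm : ∫ x, f x ∂ν ≤ m) (n : ℕ) :
    (Measure.pi fun _ : Fin n => ν).real {ω | 2 * n * m + b * t ≤ ∑ i, f (ω i)}
      ≤ Real.exp (-t) := by
  have hi : Integrable f ν := by
    refine (integrable_const b).mono' hf.aestronglyMeasurable (ae_of_all _ fun x => ?_)
    rw [Real.norm_eq_abs, abs_of_nonneg (hf0 x)]
    exact hfb x
  -- On [0, 1] one has exp u ≤ 1 + 2 u. The slope 2 is the factor in front of the mean in the final
  -- bound, so no variance is needed.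
  have hpt : ∀ x, Real.exp (1 / b * f x) ≤ 1 + 2 / b * f x := by
    intro x
    have h1 : 1 / b * f x ≤ 1 := by rw [one_div_mul_eq_div, div_le_one hb]; exact hfb x
    have h0 : 0 ≤ 1 / b * f x := mul_nonneg (by positivity) (hf0 x)
    have := (abs_le.1 (Real.abs_exp_sub_one_sub_id_le (x := 1 / b * f x)
      (by rwa [abs_of_nonneg h0]))).2
    have e : 2 / b * f x = 2 * (1 / b * f x) := by ring
    rw [e]
    nlinarith
  have hi2 : Integrable (fun x => 1 + 2 / b * f x) ν := (integrable_const _).add (hi.const_mul _)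
  have hie : Integrable (fun x => Real.exp (1 / b * f x)) ν := by
    refine hi2.mono' (by fun_prop) (ae_of_all _ fun x => ?_)
    rw [Real.norm_eq_abs, Real.abs_exp]
    exact hpt x
  have hmgf : mgf f ν (1 / b) ≤ Real.exp (2 / b * m) := by
    have := integral_mono hie hi2 hpt
    rw [integral_add (integrable_const _) (hi.const_mul _), integral_const_mul] at this
    simp only [integral_const, probReal_univ, smul_eq_mul, mul_one] at this
    have h2 : 2 / b * ∫ x, f x ∂ν ≤ 2 / b * m := by gcongr
    unfold mgf
    linarith [Real.add_one_le_exp (2 / b * m)]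
  refine (pi_measureReal_ge_le_exp_mul_prod_mgf (fun _ => f)
    (by positivity : 0 ≤ 1 / b) (fun _ => hie) _).trans ?_
  calc _ ≤ Real.exp (-(1 / b) * (2 * n * m + b * t)) * ∏ _i : Fin n, Real.exp (2 / b * m) := by
        gcongr
        · exact fun i _ => mgf_nonneg
    _ = Real.exp (-t) := by
        rw [Finset.prod_const, Finset.card_univ, Fintype.card_fin, ← Real.exp_nat_mul,
          ← Real.exp_add]
        congr 1
        field_simp
        ring

lemma pi_measureReal_exists_le {f : E → Prop} (n : ℕ) :
    (Measure.pi fun _ : Fin n => ν).real {ω | ∃ i, f (ω i)} ≤ n * ν.real {x | f x} := by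
  have : {ω : Fin n → E | ∃ i, f (ω i)} = ⋃ i, {ω | f (ω i)} := by ext; simp
  rw [this]
  refine (measureReal_iUnion_fintype_le _).trans ?_
  have h : ∀ i : Fin n, (Measure.pi fun _ : Fin n => ν).real {ω | f (ω i)} ≤ ν.real {x | f x} := by
    intro i
    refine ENNReal.toReal_mono (measure_ne_top _ _) ?_
    have := (measurePreserving_eval (fun _ : Fin n => ν) i).measure_preimage_le {x | f x}
    exact this
  exact (Finset.sum_le_sum fun i _ => h i).trans (by simp)

end Bernstein

/-! ### Moments of the standard exponential law -/

instance isProbabilityMeasure_expMeasure_one : IsProbabilityMeasure (expMeasure 1) :=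
  isProbabilityMeasure_expMeasure one_pos

lemma expMeasure_one_eq : expMeasure 1
    = (volume.restrict (Set.Ioi (0 : ℝ))).withDensity fun x => ENNReal.ofReal (Real.exp (-x)) := by
  have h : expMeasure 1 = volume.withDensity (Set.indicator (Set.Ioi 0)
      fun x => ENNReal.ofReal (Real.exp (-x))) := by
    refine withDensity_congr_ae ?_
    have : ∀ᵐ x : ℝ, x ≠ 0 := by simp [ae_iff]
    filter_upwards [this] with x hx
    rcases lt_or_gt_of_ne hx with h | h
    · rw [gammaPDF_of_neg h, Set.indicator_of_notMem (by simp [h.le])]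
    · rw [gammaPDF_of_nonneg h.le, Set.indicator_of_mem (by simpa using h)]
      simp
  rw [h, withDensity_indicator measurableSet_Ioi]

lemma integral_expMeasure_one (f : ℝ → ℝ) :
    ∫ x, f x ∂(expMeasure 1) = ∫ x in Set.Ioi 0, Real.exp (-x) * f x := by
  rw [expMeasure_one_eq, integral_withDensity_eq_integral_toReal_smul (by fun_prop)
    (ae_of_all _ fun _ => ENNReal.ofReal_lt_top)]
  simp [ENNReal.toReal_ofReal (Real.exp_pos _).le]

lemma integrable_expMeasure_one_iff {f : ℝ → ℝ} :
    Integrable f (expMeasure 1) ↔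
      IntegrableOn (fun x => Real.exp (-x) * f x) (Set.Ioi 0) := by
  rw [expMeasure_one_eq, integrable_withDensity_iff_integrable_smul' (by fun_prop)
    (ae_of_all _ fun _ => ENNReal.ofReal_lt_top), IntegrableOn]
  simp [ENNReal.toReal_ofReal (Real.exp_pos _).le]

lemma ae_expMeasure_one_pos : ∀ᵐ x ∂(expMeasure 1), 0 < x := by
  rw [expMeasure_one_eq]
  refine (withDensity_absolutelyContinuous _ _).ae_le ?_
  exact ae_restrict_mem measurableSet_Ioi

lemma integrable_expMeasure_one_pow (k : ℕ) : Integrable (fun x => x ^ k) (expMeasure 1) := by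
  rw [integrable_expMeasure_one_iff]
  refine (Real.GammaIntegral_convergent (s := k + 1) (by positivity)).congr_fun (fun x _ => ?_)
    measurableSet_Ioi
  simp

lemma integral_expMeasure_one_pow (k : ℕ) : ∫ x, x ^ k ∂(expMeasure 1) = k.factorial := by
  rw [integral_expMeasure_one, ← Real.Gamma_nat_eq_factorial,
    Real.Gamma_eq_integral (by positivity)]
  simp

lemma integral_expMeasure_one_sub_one : ∫ x, (x - 1) ∂(expMeasure 1) = 0 := by
  have h := integral_expMeasure_one_pow 1
  have hi := integrable_expMeasure_one_pow 1
  simp only [pow_one, Nat.factorial_one, Nat.cast_one] at h hi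
  rw [integral_sub hi (integrable_const _), h]
  simp

lemma integral_expMeasure_one_sub_one_sq : ∫ x, (x - 1) ^ 2 ∂(expMeasure 1) = 1 := by
  have h := integral_expMeasure_one_pow 1
  have hi := integrable_expMeasure_one_pow 1
  have h2 := integral_expMeasure_one_pow 2
  have hi2 := integrable_expMeasure_one_pow 2
  simp only [pow_one, Nat.factorial_one, Nat.cast_one] at h hi
  have e : ∀ x : ℝ, (x - 1) ^ 2 = x ^ 2 - (2 * x - 1) := fun x => by ring
  have i3 : Integrable (fun x : ℝ => 2 * x - 1) (expMeasure 1) :=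
    (hi.const_mul 2).sub (integrable_const _)
  simp_rw [e]
  rw [integral_sub hi2 i3, integral_sub (hi.const_mul 2) (integrable_const _), integral_const_mul,
    h, h2]
  norm_num [Nat.factorial]

lemma exp_abs_sub_one_div_four_le {x : ℝ} (hx : 0 < x) :
    Real.exp |(x - 1) / 4| ≤ Real.exp (1 / 4) * Real.exp (x / 4) := by
  rw [← Real.exp_add, abs_div]
  refine Real.exp_le_exp.2 ?_
  have : |x - 1| ≤ x + 1 := abs_le.2 ⟨by linarith, by linarith⟩
  norm_num
  linarith

lemma integrable_expMeasure_one_exp : Integrable (fun x => Real.exp (x / 4)) (expMeasure 1) := by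
  rw [integrable_expMeasure_one_iff]
  refine (integrableOn_exp_mul_Ioi (a := -(3 / 4)) (by norm_num) 0).congr_fun (fun x _ => ?_)
    measurableSet_Ioi
  simp only
  rw [← Real.exp_add]
  ring_nf

lemma integral_expMeasure_one_exp : ∫ x, Real.exp (x / 4) ∂(expMeasure 1) = 4 / 3 := by
  rw [integral_expMeasure_one]
  have e : ∀ x : ℝ, Real.exp (-x) * Real.exp (x / 4) = Real.exp (-(3 / 4) * x) := fun x => by
    rw [← Real.exp_add]; ring_nf
  simp_rw [e]
  rw [integral_exp_mul_Ioi (by norm_num)]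
  norm_num

lemma integrable_expMeasure_one_exp_abs :
    Integrable (fun x => Real.exp |(x - 1) / 4|) (expMeasure 1) := by
  refine (integrable_expMeasure_one_exp.const_mul (Real.exp (1 / 4))).mono' (by fun_prop) ?_
  filter_upwards [ae_expMeasure_one_pos] with x hx
  rw [Real.norm_eq_abs, Real.abs_exp]
  exact exp_abs_sub_one_div_four_le hx

lemma integral_expMeasure_one_exp_abs_le :
    ∫ x, Real.exp |(x - 1) / 4| ∂(expMeasure 1) ≤ 2 := by
  have h := integral_mono_ae integrable_expMeasure_one_exp_abs
    (integrable_expMeasure_one_exp.const_mul (Real.exp (1 / 4)))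
    (by filter_upwards [ae_expMeasure_one_pos] with x hx using exp_abs_sub_one_div_four_le hx)
  rw [integral_const_mul, integral_expMeasure_one_exp] at h
  -- The scale 4 is large enough because (3/2) · (4/3) = 2. The numerical bound follows from (3/2)⁴
  -- > e.
  have : Real.exp (1 / 4) ≤ 3 / 2 := by
    by_contra! hcon
    have h4 : Real.exp (1 / 4) ^ 4 = Real.exp 1 := by
      rw [← Real.exp_nat_mul]; norm_num
    have h5 : (3 / 2 : ℝ) ^ 4 < Real.exp (1 / 4) ^ 4 := by gcongr
    have := Real.exp_one_lt_d9
    rw [h4] at h5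
    norm_num at h5
    linarith
  linarith

lemma integrable_expMeasure_one_abs_sub_one_cube :
    Integrable (fun x => |x - 1| ^ 3) (expMeasure 1) := by
  -- The constant is 4³ · 3!, from u³ / 3! ≤ exp u at u = |x - 1| / 4.
  refine (integrable_expMeasure_one_exp_abs.const_mul 384).mono' (by fun_prop)
    (ae_of_all _ fun x => ?_)
  have := Real.pow_div_factorial_le_exp |(x - 1) / 4| (abs_nonneg _) 3
  rw [abs_div, div_pow] at this
  rw [abs_div]
  rw [Real.norm_eq_abs, abs_of_nonneg (by positivity)]
  norm_num [Nat.factorial] at this ⊢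
  linarith

/-- Bernstein's inequality for weighted sums of centred standard exponential variables. -/
lemma pi_expMeasure_abs_sum_sub_one_mul_ge_le {n : ℕ} (a : Fin n → ℝ) {v B t : ℝ} (hv : 0 < v)
    (hB : 0 < B) (ht : 0 ≤ t) (hav : ∑ i, a i ^ 2 ≤ v) (haB : ∀ i, |a i| ≤ B) :
    (Measure.pi fun _ : Fin n => expMeasure 1).real
      {ω | 32 * √(v * t) + 16 * B * t ≤ |∑ i, (ω i - 1) * a i|} ≤ 2 * Real.exp (-t) := by
  have h := pi_measureReal_abs_weighted_sum_ge_le (ν := expMeasure 1) (D := fun x => (x - 1) / 4)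
    (by fun_prop) integrable_expMeasure_one_exp_abs integral_expMeasure_one_exp_abs_le
    (by rw [integral_div, integral_expMeasure_one_sub_one, zero_div]) a hv hB ht hav haB
  refine le_trans (measureReal_mono fun ω hω => ?_) h
  have e : ∑ i, a i * ((ω i - 1) / 4) = (∑ i, (ω i - 1) * a i) / 4 := by
    rw [Finset.sum_div]
    exact Finset.sum_congr rfl fun i _ => by ring
  simp only [Set.mem_ofPred_eq] at hω ⊢
  rw [e, abs_div]
  norm_num
  linarith

/-! ### Quantiles and the standard normal distribution function -/

section Quantile

variable {ν : Measure ℝ} [IsProbabilityMeasure ν] {τ y : ℝ}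

/-- Positivity of τ keeps the defining set bounded below; on an unbounded set the real infimum takes
the default value 0. In `lt_quantile_of_lt` the condition τ < 1 plays the same role by making the
set nonempty. -/
lemma quantile_le_of_le (hτ : 0 < τ) (h : τ ≤ ν.real (Set.Iic y)) : quantile ν τ ≤ y := by
  refine csInf_le ?_ h
  obtain ⟨x, hx⟩ := ((tendsto_cdf_atBot ν).eventually_lt_const hτ).exists
  refine ⟨x, fun z hz => ?_⟩
  by_contra! hzx
  have := (cdf ν).mono hzx.le
  rw [cdf_eq_real, cdf_eq_real] at this
  rw [cdf_eq_real] at hx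
  rw [Set.mem_ofPred_eq] at hz
  linarith

lemma lt_quantile_of_lt (hτ : τ < 1) (h : ν.real (Set.Iic y) < τ) : y < quantile ν τ := by
  have hrc : ContinuousWithinAt (cdf ν) (Set.Ici y) y := (cdf ν).right_continuous y
  rw [← cdf_eq_real] at h
  have hev : ∀ᶠ x in 𝓝[>] y, cdf ν x < τ :=
    (hrc.mono Set.Ioi_subset_Ici_self).eventually_lt_const h
  obtain ⟨x, hx, hyx⟩ := (hev.and self_mem_nhdsWithin).exists
  refine lt_of_lt_of_le hyx (le_csInf ?_ fun z hz => ?_)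
  · obtain ⟨w, hw⟩ := ((tendsto_cdf_atTop ν).eventually_const_lt hτ).exists
    rw [cdf_eq_real] at hw
    exact ⟨w, hw.le⟩
  · by_contra! hzx
    have := (cdf ν).mono hzx.le
    rw [Set.mem_ofPred_eq, ← cdf_eq_real] at hz
    linarith

/-- A strict bound needs a point left of y that already carries mass τ. The open half-line, as an
increasing union of closed ones, supplies it even if y is an atom. -/
lemma quantile_lt_of_lt (hτ : 0 < τ) (h : τ < ν.real (Set.Iio y)) : quantile ν τ < y := by
  have hU : (⋃ k : ℕ, Set.Iic (y - 1 / ((k : ℝ) + 1))) = Set.Iio y := by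
    ext x
    simp only [Set.mem_iUnion, Set.mem_Iic, Set.mem_Iio]
    constructor
    · rintro ⟨k, hk⟩
      have : 0 < 1 / ((k : ℝ) + 1) := by positivity
      linarith
    · intro hx
      obtain ⟨k, hk⟩ := exists_nat_one_div_lt (sub_pos.2 hx)
      exact ⟨k, by linarith⟩
  have hm : Monotone fun k : ℕ => Set.Iic (y - 1 / ((k : ℝ) + 1)) := by
    intro k l hkl
    refine Set.Iic_subset_Iic.2 ?_
    have : 1 / ((l : ℝ) + 1) ≤ 1 / ((k : ℝ) + 1) := by gcongr
    linarith
  have ht := tendsto_measure_iUnion_atTop (μ := ν) hm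
  rw [hU] at ht
  have ht' : Tendsto (fun k : ℕ => ν.real (Set.Iic (y - 1 / ((k : ℝ) + 1)))) atTop
      (𝓝 (ν.real (Set.Iio y))) := (ENNReal.tendsto_toReal (measure_ne_top _ _)).comp ht
  obtain ⟨k, hk⟩ := (ht'.eventually_const_lt h).exists
  have := quantile_le_of_le hτ hk.le
  have : 0 < 1 / ((k : ℝ) + 1) := by positivity
  linarith

end Quantile

lemma continuous_gaussianReal_Iic :
    Continuous fun x => (gaussianReal 0 1).real (Set.Iic x) := by
  have := nullSingletonClass_gaussianReal (μ := 0) (v := 1) one_ne_zero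
  simp_rw [← cdf_eq_real]
  refine continuous_iff_continuousAt.2 fun x => ?_
  rw [(cdf (gaussianReal 0 1)).mono.continuousAt_iff_leftLim_eq_rightLim,
    StieltjesFunction.rightLim_eq]
  have h := (cdf (gaussianReal 0 1)).measure_singleton x
  rw [measure_cdf, measure_singleton] at h
  have h1 := ENNReal.ofReal_eq_zero.1 h.symm
  exact le_antisymm ((cdf (gaussianReal 0 1)).mono.leftLim_le le_rfl) (by linarith)

lemma strictMono_gaussianReal_Iic :
    StrictMono fun x => (gaussianReal 0 1).real (Set.Iic x) := by
  intro x y hxy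
  have h0 : gaussianReal 0 1 (Set.Ioc x y) ≠ 0 := by
    intro h
    have := gaussianReal_absolutelyContinuous' 0 (v := 1) one_ne_zero h
    rw [Real.volume_Ioc, ENNReal.ofReal_eq_zero] at this
    linarith
  have h1 : 0 < (gaussianReal 0 1).real (Set.Ioc x y) := by
    rw [measureReal_def]
    exact ENNReal.toReal_pos h0 (measure_ne_top _ _)
  have h2 : (gaussianReal 0 1).real (Set.Iic y)
      = (gaussianReal 0 1).real (Set.Iic x) + (gaussianReal 0 1).real (Set.Ioc x y) := by
    have hd : Disjoint (Set.Iic x) (Set.Ioc x y) :=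
      Set.disjoint_left.2 fun z hz hz' => not_lt.2 hz hz'.1
    rw [← Set.Iic_union_Ioc_eq_Iic hxy.le, measureReal_union hd measurableSet_Ioc]
  simp only
  linarith

lemma exists_gaussianReal_Iic_eq {τ : ℝ} (h0 : 0 < τ) (h1 : τ < 1) :
    ∃ a, (gaussianReal 0 1).real (Set.Iic a) = τ := by
  obtain ⟨x, hx⟩ := ((tendsto_cdf_atBot (gaussianReal 0 1)).eventually_lt_const h0).exists
  obtain ⟨y, hy⟩ := ((tendsto_cdf_atTop (gaussianReal 0 1)).eventually_const_lt h1).exists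
  rw [cdf_eq_real] at hx hy
  exact mem_range_of_exists_le_of_exists_ge continuous_gaussianReal_Iic ⟨x, hx.le⟩ ⟨y, hy.le⟩

/-! ### Sub-Gaussian variables -/

section SubGaussian

variable {E : Type*} [MeasurableSpace E] {ν : Measure E}

/-- `E[exp (U² / K²)] ≤ 2`. -/
def ExpSqBound (ν : Measure E) (U : E → ℝ) (K : ℝ) : Prop :=
  Integrable (fun x => Real.exp (U x ^ 2 / K ^ 2)) ν ∧ ∫ x, Real.exp (U x ^ 2 / K ^ 2) ∂ν ≤ 2

/-- The strict gap K < K' yields an admissible t below K', so attainment of the infimum is not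
needed. -/
lemma expSqBound_of_psi2Norm_le {U : E → ℝ} (hU : Measurable U) {K K' : ℝ} (hKK : K < K')
    (hK' : 0 < K') (h : psi2Norm ν U ≤ ENNReal.ofReal K) : ExpSqBound ν U K' := by
  have hlt : psi2Norm ν U < ENNReal.ofReal K' :=
    h.trans_lt ((ENNReal.ofReal_lt_ofReal_iff hK').2 hKK)
  unfold psi2Norm at hlt
  simp only [iInf_lt_iff] at hlt
  obtain ⟨t, ht, hle, htK⟩ := hlt
  have htK' : t < K' := (ENNReal.ofReal_lt_ofReal_iff hK').1 htK
  have hm : Measurable fun x => Real.exp (U x ^ 2 / K' ^ 2) := by fun_prop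
  have hle' : ∫⁻ x, ENNReal.ofReal (Real.exp (U x ^ 2 / K' ^ 2)) ∂ν ≤ 2 := by
    refine (lintegral_mono fun x => ENNReal.ofReal_le_ofReal (Real.exp_le_exp.2 ?_)).trans hle
    gcongr
  have hi : Integrable (fun x => Real.exp (U x ^ 2 / K' ^ 2)) ν := by
    refine ⟨hm.aestronglyMeasurable, ?_⟩
    rw [hasFiniteIntegral_iff_ofReal (ae_of_all _ fun x => (Real.exp_pos _).le)]
    exact hle'.trans_lt ENNReal.ofNat_lt_top
  refine ⟨hi, ?_⟩
  rw [integral_eq_lintegral_of_nonneg_ae (ae_of_all _ fun x => (Real.exp_pos _).le)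
    hm.aestronglyMeasurable]
  exact ENNReal.toReal_le_of_le_ofReal (by norm_num) (by simpa using hle')

lemma psi2Norm_coord_le_psi2NormVec {p : ℕ} (V : E → Fin p → ℝ) (k : Fin p) :
    psi2Norm ν (fun x => V x k) ≤ psi2NormVec ν V := by
  unfold psi2NormVec
  refine le_trans (le_of_eq ?_) (le_iSup₂ (f := fun (x : Fin p → ℝ) (_ : ∑ k, x k ^ 2 = 1) =>
    psi2Norm ν fun ω => V ω ⬝ᵥ x) (Pi.single k 1) ?_)
  · simp
  · simp [Pi.single_apply]

namespace ExpSqBound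

variable {U V : E → ℝ} {K : ℝ}

lemma measureReal_le (h : ExpSqBound ν U K) (hK : 0 < K) (t : ℝ) :
    ν.real {x | K ^ 2 * t ≤ U x ^ 2} ≤ 2 * Real.exp (-t) := by
  have := measureReal_ge_le_two_mul_exp h.1 h.2 t
  simp only [le_div_iff₀ (pow_pos hK 2)] at this
  simpa only [mul_comm] using this

lemma pow_four_le (hK : 0 < K) (u : ℝ) : u ^ 4 ≤ 2 * K ^ 4 * Real.exp (u ^ 2 / K ^ 2) := by
  have := Real.pow_div_factorial_le_exp (u ^ 2 / K ^ 2) (by positivity) 2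
  rw [div_pow, div_div, div_le_iff₀ (by positivity)] at this
  norm_num [Nat.factorial] at this
  nlinarith

lemma integrable_pow_four (h : ExpSqBound ν U K) (hK : 0 < K) (hU : Measurable U) :
    Integrable (fun x => U x ^ 4) ν := by
  refine (h.1.const_mul (2 * K ^ 4)).mono' (by fun_prop) (ae_of_all _ fun x => ?_)
  rw [Real.norm_eq_abs, abs_of_nonneg (by positivity)]
  exact pow_four_le hK (U x)

lemma integral_pow_four_le (h : ExpSqBound ν U K) (hK : 0 < K) (hU : Measurable U) :
    ∫ x, U x ^ 4 ∂ν ≤ 4 * K ^ 4 := by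
  refine (integral_mono (h.integrable_pow_four hK hU) (h.1.const_mul (2 * K ^ 4))
    fun x => pow_four_le hK (U x)).trans ?_
  rw [integral_const_mul]
  nlinarith [h.2, pow_pos hK 4]

/-- The inequality between arithmetic and geometric means is applied twice, to the exponent and then
to the exponentials. Hence products of sub-Gaussian variables, such as X_k ε, are sub-exponential
and obey Bernstein's inequality. -/
lemma exp_abs_mul_le (hK : 0 < K) (u v : ℝ) : Real.exp |u * v / K ^ 2|
    ≤ (Real.exp (u ^ 2 / K ^ 2) + Real.exp (v ^ 2 / K ^ 2)) / 2 := by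
  have h1 : |u * v / K ^ 2| ≤ (u ^ 2 / K ^ 2) / 2 + (v ^ 2 / K ^ 2) / 2 := by
    rw [abs_div, abs_mul, abs_of_pos (pow_pos hK 2), ← sq_abs u, ← sq_abs v, ← add_div,
      ← add_div, div_right_comm]
    gcongr
    nlinarith [sq_nonneg (|u| - |v|)]
  refine (Real.exp_le_exp.2 h1).trans ?_
  rw [Real.exp_add]
  have e : ∀ y, Real.exp y = Real.exp (y / 2) ^ 2 := fun y => by
    rw [← Real.exp_nat_mul]; congr 1; push_cast; ring
  rw [e (u ^ 2 / K ^ 2), e (v ^ 2 / K ^ 2)]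
  nlinarith [sq_nonneg (Real.exp (u ^ 2 / K ^ 2 / 2) - Real.exp (v ^ 2 / K ^ 2 / 2))]

lemma integrable_exp_abs_mul (h : ExpSqBound ν U K) (h' : ExpSqBound ν V K) (hK : 0 < K)
    (hU : Measurable U) (hV : Measurable V) :
    Integrable (fun x => Real.exp |U x * V x / K ^ 2|) ν := by
  refine ((h.1.add h'.1).div_const 2).mono' (by fun_prop) (ae_of_all _ fun x => ?_)
  rw [Real.norm_eq_abs, Real.abs_exp]
  exact exp_abs_mul_le hK _ _

lemma integral_exp_abs_mul_le (h : ExpSqBound ν U K) (h' : ExpSqBound ν V K) (hK : 0 < K)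
    (hU : Measurable U) (hV : Measurable V) :
    ∫ x, Real.exp |U x * V x / K ^ 2| ∂ν ≤ 2 := by
  refine (integral_mono (h.integrable_exp_abs_mul h' hK hU hV) ((h.1.add h'.1).div_const 2)
    fun x => exp_abs_mul_le hK _ _).trans ?_
  simp only [Pi.add_apply]
  rw [integral_div, integral_add h.1 h'.1]
  linarith [h.2, h'.2]

lemma integrable_mul (h : ExpSqBound ν U K) (h' : ExpSqBound ν V K) (hK : 0 < K)
    (hU : Measurable U) (hV : Measurable V) : Integrable (fun x => U x * V x) ν := by
  have := (integrable_of_integrable_exp_abs (by fun_prop)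
    (h.integrable_exp_abs_mul h' hK hU hV)).mul_const (K ^ 2)
  refine this.congr (ae_of_all _ fun x => ?_)
  have := (pow_pos hK 2).ne'
  simp only
  field_simp

end ExpSqBound

end SubGaussian

/-! ### Laws of large numbers over the rows of a triangular array -/

section Row

variable {E : Type*} [MeasurableSpace E] {ν : Measure E} [IsProbabilityMeasure ν]

lemma integrable_comp_eval_pi {f : E → ℝ} (hf : Integrable f ν) {n : ℕ} (i : Fin n) :
    Integrable (fun ω : Fin n → E => f (ω i)) (Measure.pi fun _ : Fin n => ν) :=
  (measurePreserving_eval (fun _ : Fin n => ν) i).integrable_comp_of_integrable hf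

lemma integral_sum_comp_eval_pi {f : E → ℝ} (hf : Integrable f ν) (n : ℕ) :
    ∫ ω, ∑ i, f (ω i) ∂(Measure.pi fun _ : Fin n => ν) = n * ∫ x, f x ∂ν := by
  rw [integral_finsetSum _ fun i _ => integrable_comp_eval_pi hf i]
  have : ∀ i : Fin n, ∫ ω, f (ω i) ∂(Measure.pi fun _ : Fin n => ν) = ∫ x, f x ∂ν := fun i => by
    have hm := measurePreserving_eval (fun _ : Fin n => ν) i
    have h := integral_map (f := f) hm.measurable.aemeasurable
      (by rw [hm.map_eq]; exact hf.aestronglyMeasurable)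
    rw [hm.map_eq] at h
    exact h.symm
  simp [this]

lemma pi_measureReal_sum_ge_le_div {f : E → ℝ} (hf : Integrable f ν) (hf0 : ∀ x, 0 ≤ f x) {c : ℝ}
    (hc : 0 < c) (n : ℕ) :
    (Measure.pi fun _ : Fin n => ν).real {ω | c ≤ ∑ i, f (ω i)} ≤ n * (∫ x, f x ∂ν) / c := by
  rw [le_div_iff₀ hc, mul_comm, ← integral_sum_comp_eval_pi hf]
  exact mul_meas_ge_le_integral_of_nonneg
    (ae_of_all _ fun ω => Finset.sum_nonneg fun i _ => hf0 (ω i))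
    (integrable_finsetSum _ fun i _ => integrable_comp_eval_pi hf i) c

/-- A weak law of large numbers for squares under a third moment bound, by truncation at `√n`. -/
lemma pi_measureReal_abs_sum_sq_sub_ge_le {D : E → ℝ} (hD : Measurable D)
    (h3 : Integrable (fun x => |D x| ^ 3) ν) (h2 : ∫ x, D x ^ 2 ∂ν = 1) {M : ℝ}
    (hM : ∫ x, |D x| ^ 3 ∂ν ≤ M) {δ : ℝ} (hδ : 0 < δ) {n : ℕ} (hn : 0 < n)
    (hnM : 4 * M ≤ δ * √n) :
    (Measure.pi fun _ : Fin n => ν).real {ω | n * δ ≤ |∑ i, D (ω i) ^ 2 - n|}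
      ≤ (4 / δ ^ 2 + 4 / δ) * M / √n := by
  have hn' : (0 : ℝ) < n := Nat.cast_pos.2 hn
  set R := √(n : ℝ) with hR
  have hR0 : 0 < R := Real.sqrt_pos.2 hn'
  have hRR : R * R = n := Real.mul_self_sqrt hn'.le
  -- The third moment bounds both parts: f² ≤ √n |D|³ feeds Chebyshev's inequality, and D² - f ≤
  -- |D|³ / √n feeds Markov's. The deviation δ is divided into δ/2 for the truncated sum, δ/4 for
  -- the tail and δ/4 for the bias.
  let f : E → ℝ := fun x => if |D x| ≤ R then D x ^ 2 else 0
  have hfm : Measurable f := Measurable.ite (measurableSet_le (by fun_prop) measurable_const)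
    (by fun_prop) measurable_const
  have hfb : ∀ x, |f x| ≤ R ^ 2 := by
    intro x
    simp only [f]
    split_ifs with h
    · rw [abs_pow]; gcongr
    · simp; positivity
  have hfL : MemLp f 2 ν := MemLp.of_bound hfm.aestronglyMeasurable (R ^ 2)
    (ae_of_all _ fun x => by simpa using hfb x)
  have hfi : Integrable f ν := hfL.integrable (by norm_num)
  have hf2 : ∀ x, f x ^ 2 ≤ R * |D x| ^ 3 := by
    intro x
    simp only [f]
    split_ifs with h
    · have : (D x ^ 2) ^ 2 = |D x| * |D x| ^ 3 := by rw [← sq_abs (D x)]; ring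
      rw [this]; gcongr
    · simp; positivity
  have hg : ∀ x, 0 ≤ D x ^ 2 - f x ∧ D x ^ 2 - f x ≤ |D x| ^ 3 / R := by
    intro x
    simp only [f]
    split_ifs with h
    · simp; positivity
    · push Not at h
      refine ⟨by simp; positivity, ?_⟩
      rw [sub_zero, le_div_iff₀ hR0, ← sq_abs]
      nlinarith [sq_nonneg |D x|]
  -- Without integrability the integral would have the default value 0 instead of 1.
  have hD2 : Integrable (fun x => D x ^ 2) ν := by
    by_contra hcon
    rw [integral_undef hcon] at h2
    norm_num at h2
  have hgi : Integrable (fun x => D x ^ 2 - f x) ν := hD2.sub hfi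
  have hgE : ∫ x, (D x ^ 2 - f x) ∂ν ≤ M / R := by
    refine (integral_mono hgi (h3.div_const R) fun x => (hg x).2).trans ?_
    rw [integral_div]
    gcongr
  have hM0 : 0 ≤ M := le_trans (integral_nonneg fun x => by positivity) hM
  have hvar : Var[f; ν] ≤ R * M := by
    refine (variance_le_expectation_sq hfm.aestronglyMeasurable).trans ?_
    refine (integral_mono hfL.integrable_sq (h3.const_mul R) fun x => hf2 x).trans ?_
    rw [integral_const_mul]
    gcongr
  have hEf : ∫ ω, ∑ i, f (ω i) ∂(Measure.pi fun _ : Fin n => ν) = n * ∫ x, f x ∂ν :=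
    integral_sum_comp_eval_pi hfi n
  have hcheb : (Measure.pi fun _ : Fin n => ν).real
      {ω | n * (δ / 2) ≤ |∑ i, f (ω i) - n * ∫ x, f x ∂ν|} ≤ 4 / δ ^ 2 * M / R := by
    have hL : MemLp (∑ i : Fin n, fun ω : Fin n → E => f (ω i)) 2
        (Measure.pi fun _ : Fin n => ν) :=
      memLp_finsetSum' _ fun i _ =>
        hfL.comp_measurePreserving (measurePreserving_eval (fun _ : Fin n => ν) i)
    have h := meas_ge_le_variance_div_sq hL (c := n * (δ / 2)) (by positivity)
    rw [variance_sum_pi (μ := fun _ : Fin n => ν) (X := fun _ => f) fun _ => hfL] at h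
    simp only [Finset.sum_apply, hEf, Finset.sum_const, Finset.card_univ, Fintype.card_fin,
      nsmul_eq_mul] at h
    refine (ENNReal.toReal_le_of_le_ofReal (by have := variance_nonneg f ν; positivity) h).trans ?_
    calc (n : ℝ) * Var[f; ν] / (n * (δ / 2)) ^ 2 ≤ n * (R * M) / (n * (δ / 2)) ^ 2 := by gcongr
      _ = 4 / δ ^ 2 * M / R := by
        rw [← hRR]; field_simp; norm_num
  have hmark := pi_measureReal_sum_ge_le_div hgi (fun x => (hg x).1)
    (c := n * (δ / 4)) (by positivity) n
  have hmark' : (Measure.pi fun _ : Fin n => ν).real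
      {ω | n * (δ / 4) ≤ ∑ i, (D (ω i) ^ 2 - f (ω i))} ≤ 4 / δ * M / R := by
    refine hmark.trans ?_
    calc (n : ℝ) * (∫ x, (D x ^ 2 - f x) ∂ν) / (n * (δ / 4)) ≤ n * (M / R) / (n * (δ / 4)) := by
          gcongr
      _ = 4 / δ * M / R := by field_simp
  have hbias : |∫ x, f x ∂ν - 1| ≤ δ / 4 := by
    rw [integral_sub hD2 hfi, h2] at hgE
    have h1 : M / R ≤ δ / 4 := by rw [div_le_iff₀ hR0]; linarith
    have h0 : 0 ≤ ∫ x, (D x ^ 2 - f x) ∂ν := integral_nonneg fun x => (hg x).1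
    rw [integral_sub hD2 hfi, h2] at h0
    exact abs_le.2 ⟨by linarith, by linarith⟩
  refine (measureReal_mono (fun ω hω => ?_)).trans
    ((measureReal_union_le _ _).trans ((add_le_add hcheb hmark').trans ?_))
  · by_contra hcon
    simp only [Set.mem_union, Set.mem_ofPred_eq, not_or, not_le] at hcon hω
    obtain ⟨h1, h2'⟩ := hcon
    have h3' : 0 ≤ ∑ i, (D (ω i) ^ 2 - f (ω i)) := Finset.sum_nonneg fun i _ => (hg _).1
    rw [Finset.sum_sub_distrib] at h2' h3'
    have h4 := abs_lt.1 h1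
    have h5 := abs_le.1 hbias
    have h6 : n * (∫ x, f x ∂ν - 1) ≤ n * (δ / 4) := by gcongr; exact h5.2
    have h7 : n * (-(δ / 4)) ≤ n * (∫ x, f x ∂ν - 1) := by gcongr; exact h5.1
    have : |∑ i, D (ω i) ^ 2 - n| < n * δ := abs_lt.2 ⟨by linarith, by nlinarith⟩
    linarith
  · exact le_of_eq (by ring)

end Row

/-! ### Maximal inequalities -/

section Maximal

variable {E : Type*} [MeasurableSpace E] {ν : Measure E} [IsProbabilityMeasure ν]
  {ι : Type*} [Fintype ι] {U : ι → E → ℝ} {K : ℝ}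

lemma measureReal_exists_le_card_mul {F : Type*} [MeasurableSpace F] (P : Measure F)
    {S : ι → F → Prop} {c : ℝ} (h : ∀ k, P.real {x | S k x} ≤ c) :
    P.real {x | ∃ k, S k x} ≤ Fintype.card ι * c := by
  have : {x | ∃ k, S k x} = ⋃ k, {x | S k x} := by ext; simp
  rw [this]
  refine (measureReal_iUnion_fintype_le _).trans ((Finset.sum_le_sum fun k _ => h k).trans ?_)
  simp

lemma pi_measureReal_exists_sq_ge_le (hU : ∀ k, ExpSqBound ν (U k) K) (hK : 0 < K) (n : ℕ)
    (t : ℝ) :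
    (Measure.pi fun _ : Fin n => ν).real {z | ∃ i, ∃ k, K ^ 2 * t ≤ U k (z i) ^ 2}
      ≤ n * (Fintype.card ι * (2 * Real.exp (-t))) := by
  refine (pi_measureReal_exists_le (f := fun x => ∃ k, K ^ 2 * t ≤ U k x ^ 2) n).trans ?_
  gcongr
  exact measureReal_exists_le_card_mul ν fun k => (hU k).measureReal_le hK t

/-- Truncation makes the fourth powers bounded, so the Chernoff bound applies. It is inactive on the
event that all |U k (z i)|² stay below K² t, which `pi_measureReal_exists_sq_ge_le` makes likely. -/
lemma pi_measureReal_exists_sum_min_ge_le (hU : ∀ k, ExpSqBound ν (U k) K)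
    (hm : ∀ k, Measurable (U k)) (hK : 0 < K) (n : ℕ) {t s : ℝ} (ht : 0 < t) :
    (Measure.pi fun _ : Fin n => ν).real
      {z | ∃ k, 8 * n * K ^ 4 + K ^ 4 * t ^ 2 * s ≤ ∑ i, min (U k (z i) ^ 4) (K ^ 4 * t ^ 2)}
      ≤ Fintype.card ι * Real.exp (-s) := by
  refine measureReal_exists_le_card_mul _ fun k => ?_
  have hint : ∫ x, min (U k x ^ 4) (K ^ 4 * t ^ 2) ∂ν ≤ 4 * K ^ 4 := by
    refine (integral_mono_of_nonneg (ae_of_all _ fun x => ?_)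
      ((hU k).integrable_pow_four hK (hm k)) (ae_of_all _ fun x => min_le_left _ _)).trans
      ((hU k).integral_pow_four_le hK (hm k))
    exact le_min (by positivity) (by positivity)
  have hmk := hm k
  refine le_trans (le_of_eq ?_) (pi_measureReal_sum_ge_le (ν := ν) (t := s)
    (f := fun x => min (U k x ^ 4) (K ^ 4 * t ^ 2)) (by fun_prop)
    (by positivity : 0 < K ^ 4 * t ^ 2) (fun x => le_min (by positivity) (by positivity))
    (fun x => min_le_right _ _) hint n)
  congr 1
  ext z
  simp only [Set.mem_ofPred_eq]
  rw [show 2 * (n : ℝ) * (4 * K ^ 4) = 8 * n * K ^ 4 by ring]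

/-- This is the step conditional on the data: u is fixed and only the weights are random.
Bernstein's inequality is used for each pair of coordinates, its variance and sup bounds on products
following from those on single coordinates. -/
lemma pi_expMeasure_exists_abs_sum_ge_le {n : ℕ} (u : Fin n → ι → ℝ) {v t s : ℝ} (hv : 0 < v)
    (hK : 0 < K) (ht : 0 < t) (hs : 0 ≤ s) (hB : ∀ i k, u i k ^ 2 ≤ K ^ 2 * t)
    (h4 : ∀ k, ∑ i, u i k ^ 4 ≤ v) :
    (Measure.pi fun _ : Fin n => expMeasure 1).real
      {ω | ∃ kl : ι × ι, 32 * √(v * s) + 16 * (K ^ 2 * t) * s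
        ≤ |∑ i, (ω i - 1) * (u i kl.1 * u i kl.2)|}
      ≤ Fintype.card ι ^ 2 * (2 * Real.exp (-s)) := by
  refine (measureReal_exists_le_card_mul _ fun kl => ?_).trans
    (le_of_eq (by rw [Fintype.card_prod, Nat.cast_mul, sq]))
  refine pi_expMeasure_abs_sum_sub_one_mul_ge_le _ hv (by positivity) hs ?_ fun i => ?_
  · calc ∑ i, (u i kl.1 * u i kl.2) ^ 2
        ≤ ∑ i, (u i kl.1 ^ 4 + u i kl.2 ^ 4) / 2 := by
          refine Finset.sum_le_sum fun i _ => ?_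
          nlinarith [sq_nonneg (u i kl.1 ^ 2 - u i kl.2 ^ 2)]
      _ ≤ v := by
          rw [← Finset.sum_div, Finset.sum_add_distrib]
          linarith [h4 kl.1, h4 kl.2]
  · have h1 := hB i kl.1
    have h2 := hB i kl.2
    refine abs_le.2 ⟨?_, ?_⟩
    · nlinarith [sq_nonneg (u i kl.1 + u i kl.2)]
    · nlinarith [sq_nonneg (u i kl.1 - u i kl.2)]

lemma pi_measureReal_exists_abs_sum_mul_ge_le {V : E → ℝ} (hU : ∀ k, ExpSqBound ν (U k) K)
    (hV : ExpSqBound ν V K) (hm : ∀ k, Measurable (U k)) (hVm : Measurable V) (hK : 0 < K)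
    (h0 : ∀ k, ∫ x, U k x * V x ∂ν = 0) {n : ℕ} (hn : 0 < n) {s : ℝ} (hs : 0 ≤ s) :
    (Measure.pi fun _ : Fin n => ν).real
      {z | ∃ k, K ^ 2 * (8 * √(n * s) + 4 * s) ≤ |∑ i, U k (z i) * V (z i)|}
      ≤ Fintype.card ι * (2 * Real.exp (-s)) := by
  refine measureReal_exists_le_card_mul _ fun k => ?_
  have hmk := hm k
  have h := pi_measureReal_abs_weighted_sum_ge_le (ν := ν) (D := fun x => U k x * V x / K ^ 2)
    (by fun_prop) ((hU k).integrable_exp_abs_mul hV hK hmk hVm)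
    ((hU k).integral_exp_abs_mul_le hV hK hmk hVm) (by rw [integral_div, h0, zero_div])
    (fun _ : Fin n => (1 : ℝ)) (v := n) (B := 1) (t := s) (by exact_mod_cast hn) one_pos hs
    (by simp) (by simp)
  refine le_trans (measureReal_mono fun z hz => ?_) h
  simp only [Set.mem_ofPred_eq, one_mul] at hz ⊢
  rw [← Finset.sum_div, abs_div, abs_of_pos (pow_pos hK 2), le_div_iff₀ (pow_pos hK 2)]
  linarith

end Maximal

/-! ### The noise level in the debiasing step -/

/-- The coordinates of the covariate vector, together with the regression error. -/
def coordErr {p : ℕ} (β₀ : Fin p → ℝ) : Option (Fin p) → Obs p → ℝ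
  | none => err β₀
  | some k => fun z => z.2 k

/-- The rate `√(log p / n) + (log n)² (log p)² / n`. -/
noncomputable def noiseRate (n p : ℕ) : ℝ :=
  √(Real.log p / n) + Real.log n ^ 2 * Real.log p ^ 2 / n

instance isProbabilityMeasure_sampleLaw {p : ℕ} (n : ℕ) (μ : Measure (Obs p))
    [IsProbabilityMeasure μ] : IsProbabilityMeasure (sampleLaw n μ) := by
  unfold sampleLaw
  infer_instance

lemma measurable_err {p : ℕ} (β₀ : Fin p → ℝ) : Measurable (err β₀) := by
  unfold err dotProduct
  fun_prop

lemma measurable_coordErr {p : ℕ} (β₀ : Fin p → ℝ) (k : Option (Fin p)) :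
    Measurable (coordErr β₀ k) := by
  cases k with
  | none => exact measurable_err β₀
  | some k => unfold coordErr; fun_prop

/-- Deterministic bookkeeping: with t of order log n + log p and s, s' of order log p, the Bernstein
levels of the weight noise and of the score are at most a constant times n `noiseRate n p`. The
factor (log n)² (log p)² absorbs all terms other than √(n log p). -/
lemma sqrt_add_le_mul_noiseRate {K H : ℝ} (hK : 0 < K) (hH : 4 ≤ H) {n p : ℕ} (hn : 0 < n)
    (hℓ : 1 ≤ Real.log n) (hL : 1 / 2 ≤ Real.log p) {t s s' : ℝ} (ht0 : 0 < t)
    (ht : t ≤ H * (Real.log n * Real.log p)) (hs : 0 ≤ s) (hsH : s ≤ H * Real.log p)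
    (hs' : 0 ≤ s') (hsH' : s' ≤ H * Real.log p) :
    32 * √((8 * n * K ^ 4 + K ^ 4 * t ^ 2 * s) * s') + 16 * (K ^ 2 * t) * s'
        ≤ 112 * K ^ 2 * H ^ 2 * (n * noiseRate n p)
      ∧ K ^ 2 * (8 * √(n * s) + 4 * s) ≤ 112 * K ^ 2 * H ^ 2 * (n * noiseRate n p) := by
  have hn' : (0 : ℝ) < n := Nat.cast_pos.2 hn
  unfold noiseRate
  set L := Real.log p
  set l := Real.log n
  have hL0 : 0 < L := by linarith
  have hl0 : 0 < l := by linarith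
  set a := √(L / n) with ha
  set b := l ^ 2 * L ^ 2 / n with hb
  have ha0 : 0 ≤ a := Real.sqrt_nonneg _
  have hb0 : 0 ≤ b := by positivity
  have ha2 : n * a ^ 2 = L := by
    rw [ha, Real.sq_sqrt (by positivity)]; field_simp
  have hnb : n * b = l ^ 2 * L ^ 2 := by rw [hb]; field_simp
  have hlL : l * L ^ 2 ≤ n * b := by
    rw [hnb]; gcongr; nlinarith
  have hLb : L ≤ 2 * (n * b) := by
    rw [hnb]
    have h1 : 1 ≤ l ^ 2 := by nlinarith
    nlinarith [sq_nonneg L]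
  have hts : t * s' ≤ H ^ 2 * (n * b) := by
    calc t * s' ≤ (H * (l * L)) * (H * L) := by gcongr
      _ = H ^ 2 * (l * L ^ 2) := by ring
      _ ≤ _ := by gcongr
  constructor
  · have hsq : √((8 * n * K ^ 4 + K ^ 4 * t ^ 2 * s) * s') ≤ 3 * K ^ 2 * H ^ 2 * (n * (a + b)) := by
      refine Real.sqrt_le_iff.2 ⟨by positivity, ?_⟩
      have h1 : 8 * n * K ^ 4 * s' ≤ 8 * K ^ 4 * H * (n * a) ^ 2 := by
        calc 8 * n * K ^ 4 * s' ≤ 8 * n * K ^ 4 * (H * (n * a ^ 2)) := by rw [ha2]; gcongr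
          _ = _ := by ring
      have h2 : K ^ 4 * t ^ 2 * s * s' ≤ K ^ 4 * H ^ 4 * (n * b) ^ 2 := by
        calc K ^ 4 * t ^ 2 * s * s' ≤ K ^ 4 * (H * (l * L)) ^ 2 * (H * L) * (H * L) := by gcongr
          _ = K ^ 4 * H ^ 4 * (l * L ^ 2) ^ 2 := by ring
          _ ≤ _ := by gcongr
      have h3 : 8 * H ≤ 9 * H ^ 4 := by
        have : H ≤ H ^ 4 := le_self_pow₀ (by linarith) (by norm_num)
        nlinarith
      have h4 : 0 ≤ (n * a) * (n * b) := by positivity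
      calc (8 * n * K ^ 4 + K ^ 4 * t ^ 2 * s) * s'
          = 8 * n * K ^ 4 * s' + K ^ 4 * t ^ 2 * s * s' := by ring
        _ ≤ 8 * K ^ 4 * H * (n * a) ^ 2 + K ^ 4 * H ^ 4 * (n * b) ^ 2 := add_le_add h1 h2
        _ ≤ K ^ 4 * ((9 * H ^ 4) * (n * a) ^ 2) + K ^ 4 * (9 * H ^ 4) * (n * b) ^ 2
            + 18 * K ^ 4 * H ^ 4 * ((n * a) * (n * b)) := by
          have e1 : 8 * K ^ 4 * H * (n * a) ^ 2 ≤ K ^ 4 * ((9 * H ^ 4) * (n * a) ^ 2) := by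
            rw [show 8 * K ^ 4 * H * (n * a) ^ 2 = K ^ 4 * ((8 * H) * (n * a) ^ 2) by ring]
            gcongr
          have e2 : K ^ 4 * H ^ 4 * (n * b) ^ 2 ≤ K ^ 4 * (9 * H ^ 4) * (n * b) ^ 2 := by
            gcongr
            nlinarith [pow_pos (by linarith : 0 < H) 4]
          have e3 : 0 ≤ 18 * K ^ 4 * H ^ 4 * ((n * a) * (n * b)) := by positivity
          linarith
        _ = _ := by ring
    have h5 : 16 * (K ^ 2 * t) * s' ≤ 16 * K ^ 2 * (H ^ 2 * (n * (a + b))) := by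
      calc 16 * (K ^ 2 * t) * s' = 16 * K ^ 2 * (t * s') := by ring
        _ ≤ 16 * K ^ 2 * (H ^ 2 * (n * b)) := by gcongr
        _ ≤ _ := by gcongr; linarith
    linarith
  · have hsq : √(n * s) ≤ H ^ 2 * (n * (a + b)) := by
      refine Real.sqrt_le_iff.2 ⟨by positivity, ?_⟩
      calc n * s ≤ n * (H * (n * a ^ 2)) := by rw [ha2]; gcongr
        _ = H * (n * a) ^ 2 := by ring
        _ ≤ H ^ 4 * (n * (a + b)) ^ 2 := by
          gcongr
          · exact le_self_pow₀ (by linarith) (by norm_num)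
          · linarith
        _ = _ := by ring
    have h5 : s ≤ 2 * (H ^ 2 * (n * (a + b))) := by
      calc s ≤ H * L := hsH
        _ ≤ H ^ 2 * (2 * (n * b)) := by
          gcongr
          exact le_self_pow₀ (by linarith) (by norm_num)
        _ = 2 * (H ^ 2 * (n * b)) := by ring
        _ ≤ _ := by gcongr; linarith
    have h6 : K ^ 2 * (8 * √(n * s) + 4 * s) ≤ K ^ 2 * (16 * (H ^ 2 * (n * (a + b)))) := by
      gcongr; linarith
    have h7 : 0 ≤ K ^ 2 * (H ^ 2 * (n * (a + b))) := by positivity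
    linarith

/-- Three events on the data are made likely: bounded entries, bounded sums of fourth powers, and a
small score. On them the weights satisfy a conditional Bernstein bound. Indexing by `Option (Fin p)`
treats the products X_k X_l and X_k ε together. -/
lemma exists_noise_bound {K κ : ℝ} (hK : 0 < K) (hκ : 0 < κ) :
    ∃ M : ℝ, 0 < M ∧ ∀ (n p : ℕ), 3 ≤ n → 2 ≤ p → ∀ (μ : Measure (Obs p))
      [IsProbabilityMeasure μ] (β₀ : Fin p → ℝ), (∀ k, ExpSqBound μ (coordErr β₀ k) K) →
      (∀ k, ∫ z, z.2 k * err β₀ z ∂μ = 0) →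
      (sampleLaw n μ).real {z | ¬((∀ k, |(n : ℝ)⁻¹ * ∑ i, (z i).2 k * err β₀ (z i)|
          ≤ M * noiseRate n p) ∧
        (Measure.pi fun _ : Fin n => expMeasure 1).real
          {ω | ∃ k l, M * noiseRate n p <
            |(n : ℝ)⁻¹ * ∑ i, (ω i - 1) * (coordErr β₀ k (z i) * coordErr β₀ l (z i))|} ≤ κ)}
        ≤ κ := by
  set h := 5 / κ with hh
  have hh0 : 0 < h := by positivity
  have hexp : 5 * Real.exp (-h) ≤ κ := by
    have h1 := Real.add_one_le_exp h
    rw [Real.exp_neg, ← div_eq_mul_inv, div_le_iff₀ (Real.exp_pos h)]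
    have : κ * h = 5 := by rw [hh]; field_simp
    nlinarith
  have he0 := Real.exp_pos (-h)
  set H := 4 + 2 * h with hH
  refine ⟨112 * K ^ 2 * H ^ 2, by positivity, fun n p hn hp μ _ β₀ hU h0 => ?_⟩
  have hn' : (0 : ℝ) < n := by exact_mod_cast (by omega : 0 < n)
  have hp' : (2 : ℝ) ≤ p := by exact_mod_cast hp
  have hl : 1 ≤ Real.log n := by
    rw [Real.le_log_iff_exp_le hn']
    have := Real.exp_one_lt_d9
    have : (3 : ℝ) ≤ n := by exact_mod_cast hn
    linarith
  have hL : 1 / 2 ≤ Real.log p := by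
    have h1 := Real.log_two_gt_d9
    have h2 := Real.log_le_log two_pos hp'
    linarith
  set L := Real.log p with hLdef
  set l := Real.log n with hldef
  have eL : Real.exp L = p := Real.exp_log (by linarith)
  have el : Real.exp l = n := Real.exp_log hn'
  have hcard : (Fintype.card (Option (Fin p)) : ℝ) ≤ p ^ 2 := by
    simp; nlinarith
  obtain ⟨hr1, hr2⟩ := sqrt_add_le_mul_noiseRate (H := H) (n := n) (p := p) (t := l + 2 * L + h)
    (s := 2 * L + h) (s' := 4 * L + h) hK (by linarith) (by omega) hl hL (by linarith)
    (by nlinarith [mul_le_mul hl hL (by norm_num) (by linarith)]) (by linarith)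
    (by nlinarith) (by linarith) (by nlinarith)
  -- The three levels cancel the sizes n p², p² and p⁴ of the union bounds, where p + 1 ≤ p² bounds
  -- the number of indices. What remains is (2 + 1 + 2) exp (-h) ≤ κ on the data and 2 exp (-h) ≤ κ
  -- on the weights.
  set t := l + 2 * L + h
  set s := 2 * L + h
  set s' := 4 * L + h
  have hm := measurable_coordErr β₀
  have ht0 : 0 < t := by positivity
  have et : Real.exp (-t) = Real.exp (-h) / (n * p ^ 2) := by
    rw [← eL, ← el, ← Real.exp_nat_mul, ← Real.exp_add, ← Real.exp_sub]
    congr 1; simp only [t]; push_cast; ring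
  have es : Real.exp (-s) = Real.exp (-h) / p ^ 2 := by
    rw [← eL, ← Real.exp_nat_mul, ← Real.exp_sub]
    congr 1; simp only [s]; push_cast; ring
  have es' : Real.exp (-s') = Real.exp (-h) / (p ^ 2) ^ 2 := by
    rw [← eL, ← pow_mul, ← Real.exp_nat_mul, ← Real.exp_sub]
    congr 1; simp only [s']; push_cast; ring
  have b1 := pi_measureReal_exists_sq_ge_le hU hK n t
  have b2 := pi_measureReal_exists_sum_min_ge_le hU hm hK n (s := s) ht0
  have b3 := pi_measureReal_exists_abs_sum_mul_ge_le (ν := μ) (U := fun k z => z.2 k)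
    (fun k => hU (some k)) (hU none) (fun k => hm (some k)) (hm none) hK h0
    (by omega : 0 < n) (s := s) (by positivity)
  have c1 : (Measure.pi fun _ : Fin n => μ).real
      {z | ∃ i, ∃ k, K ^ 2 * t ≤ coordErr β₀ k (z i) ^ 2} ≤ 2 * Real.exp (-h) := by
    refine b1.trans ?_
    calc (n : ℝ) * (Fintype.card (Option (Fin p)) * (2 * Real.exp (-t)))
        ≤ n * (p ^ 2 * (2 * Real.exp (-t))) := by gcongr
      _ = 2 * Real.exp (-h) := by rw [et]; field_simp
  have c2 : (Measure.pi fun _ : Fin n => μ).real {z | ∃ k, 8 * n * K ^ 4 + K ^ 4 * t ^ 2 * s ≤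
      ∑ i, min (coordErr β₀ k (z i) ^ 4) (K ^ 4 * t ^ 2)} ≤ Real.exp (-h) := by
    refine b2.trans ?_
    calc (Fintype.card (Option (Fin p)) : ℝ) * Real.exp (-s) ≤ p ^ 2 * Real.exp (-s) := by gcongr
      _ = Real.exp (-h) := by rw [es]; field_simp
  have c3 : (Measure.pi fun _ : Fin n => μ).real {z | ∃ k : Fin p,
      K ^ 2 * (8 * √(n * s) + 4 * s) ≤ |∑ i, (z i).2 k * err β₀ (z i)|}
      ≤ 2 * Real.exp (-h) := by
    refine b3.trans ?_
    calc (Fintype.card (Fin p) : ℝ) * (2 * Real.exp (-s)) ≤ p ^ 2 * (2 * Real.exp (-s)) := by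
          gcongr; simp; nlinarith
      _ = 2 * Real.exp (-h) := by rw [es]; field_simp
  refine (measureReal_mono (fun z hz => ?_)).trans ((measureReal_union_le _ _).trans
    ((add_le_add ((measureReal_union_le _ _).trans (add_le_add c1 c2)) c3).trans
      (by linarith)))
  by_contra hcon
  simp only [Set.mem_union, Set.mem_ofPred_eq, not_or, not_exists, not_le] at hcon hz
  obtain ⟨⟨g1, g2⟩, g3⟩ := hcon
  refine hz ⟨fun k => ?_, ?_⟩
  · rw [abs_mul, abs_of_pos (inv_pos.2 hn'), inv_mul_le_iff₀ hn']
    linarith [g3 k]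
  · have g4 : ∀ k, ∑ i, coordErr β₀ k (z i) ^ 4 ≤ 8 * n * K ^ 4 + K ^ 4 * t ^ 2 * s := by
      intro k
      refine le_trans (le_of_eq (Finset.sum_congr rfl fun i _ => ?_)) (g2 k).le
      rw [min_eq_left]
      have := (g1 i k).le
      calc coordErr β₀ k (z i) ^ 4 = (coordErr β₀ k (z i) ^ 2) ^ 2 := by ring
        _ ≤ (K ^ 2 * t) ^ 2 := by gcongr
        _ = _ := by ring
    have b4 := pi_expMeasure_exists_abs_sum_ge_le (fun i k => coordErr β₀ k (z i))
      (v := 8 * n * K ^ 4 + K ^ 4 * t ^ 2 * s) (s := s') (by positivity) hK ht0 (by positivity)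
      (fun i k => (g1 i k).le) g4
    have c4 : (Fintype.card (Option (Fin p)) : ℝ) ^ 2 * (2 * Real.exp (-s')) ≤ κ := by
      calc (Fintype.card (Option (Fin p)) : ℝ) ^ 2 * (2 * Real.exp (-s'))
          ≤ (p ^ 2) ^ 2 * (2 * Real.exp (-s')) := by gcongr
        _ = 2 * Real.exp (-h) := by rw [es']; field_simp
        _ ≤ κ := by linarith
    refine le_trans (measureReal_mono fun ω hω => ?_) (b4.trans c4)
    obtain ⟨k, l', hkl⟩ := hω
    refine ⟨(k, l'), ?_⟩
    rw [abs_mul, abs_of_pos (inv_pos.2 hn'), lt_inv_mul_iff₀ hn'] at hkl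
    simp only
    linarith

/-! ### Norm inequalities -/

section Norms

variable {p : ℕ}

lemma l1Norm_nonneg (v : Fin p → ℝ) : 0 ≤ l1Norm v := Finset.sum_nonneg fun _ _ => abs_nonneg _

lemma abs_le_l1Norm (v : Fin p → ℝ) (k : Fin p) : |v k| ≤ l1Norm v :=
  Finset.single_le_sum (f := fun k => |v k|) (fun _ _ => abs_nonneg _) (Finset.mem_univ k)

lemma abs_mulVec_le_mul_l1Norm {A : Matrix (Fin p) (Fin p) ℝ} {c : ℝ} (k : Fin p)
    (h : ∀ l, |A k l| ≤ c) (v : Fin p → ℝ) : |(A *ᵥ v) k| ≤ c * l1Norm v := by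
  unfold l1Norm Matrix.mulVec dotProduct
  rw [Finset.mul_sum]
  refine (Finset.abs_sum_le_sum_abs _ _).trans (Finset.sum_le_sum fun l _ => ?_)
  rw [abs_mul]
  exact mul_le_mul_of_nonneg_right (h l) (abs_nonneg _)

lemma abs_apply_le_maxNorm (A : Matrix (Fin p) (Fin p) ℝ) (k l : Fin p) :
    |A k l| ≤ maxNorm A :=
  (norm_le_pi_norm (A k) l).trans (norm_le_pi_norm (fun k l => A k l : Fin p → Fin p → ℝ) k)

lemma abs_mulVec_le_opNormInf_mul (A : Matrix (Fin p) (Fin p) ℝ) {v : Fin p → ℝ} {c : ℝ}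
    (hc : 0 ≤ c) (h : ∀ l, |v l| ≤ c) (k : Fin p) : |(A *ᵥ v) k| ≤ opNormInf A * c := by
  have h1 := (LinearMap.toContinuousLinearMap (Matrix.toLin' A)).le_opNorm v
  have h2 : ‖v‖ ≤ c := (pi_norm_le_iff_of_nonneg hc).2 h
  have h3 := norm_le_pi_norm (A *ᵥ v) k
  have h4 : LinearMap.toContinuousLinearMap (Matrix.toLin' A) v = A *ᵥ v := by simp
  rw [h4] at h1
  exact (h3.trans h1).trans (mul_le_mul_of_nonneg_left h2 (norm_nonneg _))

lemma opNormInf_nonneg (A : Matrix (Fin p) (Fin p) ℝ) : 0 ≤ opNormInf A := norm_nonneg _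

lemma opNormInf_le_add_sub (A B : Matrix (Fin p) (Fin p) ℝ) :
    opNormInf A ≤ opNormInf B + opNormInf (A - B) := by
  unfold opNormInf
  have : LinearMap.toContinuousLinearMap (Matrix.toLin' A)
      = LinearMap.toContinuousLinearMap (Matrix.toLin' B)
        + LinearMap.toContinuousLinearMap (Matrix.toLin' (A - B)) := by
    rw [← map_add, ← map_add, add_sub_cancel]
  rw [this]
  exact norm_add_le _ _

end Norms

/-! ### The expansion of a debiased draw -/

section Expansion

variable {n p : ℕ}

/-- The influence `e_jᵀ Θ X ε` of one observation. -/
def influence (Θ : Matrix (Fin p) (Fin p) ℝ) (β₀ : Fin p → ℝ) (j : Fin p) (z : Obs p) : ℝ :=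
  (Θ *ᵥ z.2) j * err β₀ z

lemma measurable_influence (Θ : Matrix (Fin p) (Fin p) ℝ) (β₀ : Fin p → ℝ) (j : Fin p) :
    Measurable (influence Θ β₀ j) := by
  have := measurable_err β₀
  unfold influence Matrix.mulVec dotProduct
  fun_prop

/-- `n⁻¹ ∑ (ω_i - 1) X_i X_iᵀ`. -/
noncomputable def weightNoise (z : Sample n p) (ω : Fin n → ℝ) : Matrix (Fin p) (Fin p) ℝ :=
  Matrix.of fun k l => (n : ℝ)⁻¹ * ∑ i, (ω i - 1) * ((z i).2 k * (z i).2 l)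

/-- `n⁻¹ ∑ ω_i X_i ε_i`. -/
noncomputable def weightedScore (β₀ : Fin p → ℝ) (z : Sample n p) (ω : Fin n → ℝ) : Fin p → ℝ :=
  fun k => (n : ℝ)⁻¹ * ∑ i, ω i * ((z i).2 k * err β₀ (z i))

/-- The residual at b is the error minus Xᵀ (b - β₀), and ω_i = 1 + (ω_i - 1) separates Ω̂ from the
weight noise. The part of b - β₀ not multiplied by the mean weight minus one cancels against Θ Ω̂ (b
- β₀) up to Θ Ω̂ - 1. -/
lemma debias_expansion (Θ Θ₀ : Matrix (Fin p) (Fin p) ℝ) (β₀ b : Fin p → ℝ) (z : Sample n p)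
    {ω : Fin n → ℝ} (hω : ∑ i, ω i ≠ 0) (j : Fin p) :
    (∑ i, ω i) / n * (debias Θ z b (fun i => ω i / ∑ k, ω k) j - β₀ j)
      = (n : ℝ)⁻¹ * ∑ i, ω i * influence Θ₀ β₀ j (z i)
        + (((∑ i, ω i) / n - 1) * (b - β₀) j - ((Θ * OmegaHat z - 1) *ᵥ (b - β₀)) j
          - (Θ *ᵥ (weightNoise z ω *ᵥ (b - β₀))) j
          + ((Θ - Θ₀) *ᵥ weightedScore β₀ z ω) j) := by
  set s := ∑ i, ω i with hs
  set d := b - β₀ with hd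
  set c : Fin p → ℝ := ∑ i, (ω i / s * ((z i).1 - (z i).2 ⬝ᵥ b)) • (z i).2 with hc
  have hres : ∀ i, (z i).1 - (z i).2 ⬝ᵥ b = err β₀ (z i) - (z i).2 ⬝ᵥ d := by
    intro i
    rw [hd, dotProduct_sub, err]
    ring
  have hcs : (s / n) • c = weightedScore β₀ z ω - weightNoise z ω *ᵥ d - OmegaHat z *ᵥ d := by
    ext k
    have e1 : (weightNoise z ω *ᵥ d) k + (OmegaHat z *ᵥ d) k
        = (n : ℝ)⁻¹ * ∑ i, ω i * ((z i).2 k * ((z i).2 ⬝ᵥ d)) := by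
      simp only [Matrix.mulVec, dotProduct, weightNoise, OmegaHat, Matrix.of_apply]
      rw [← Finset.sum_add_distrib, Finset.mul_sum]
      simp_rw [Finset.mul_sum, Finset.sum_mul]
      rw [Finset.sum_comm]
      refine Finset.sum_congr rfl fun l _ => ?_
      rw [← Finset.sum_add_distrib]
      exact Finset.sum_congr rfl fun i _ => by ring
    have e2 : (s / n) * c k = (n : ℝ)⁻¹ * ∑ i, ω i * ((z i).2 k * err β₀ (z i))
        - (n : ℝ)⁻¹ * ∑ i, ω i * ((z i).2 k * ((z i).2 ⬝ᵥ d)) := by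
      rw [hc, Finset.sum_apply, ← mul_sub, ← Finset.sum_sub_distrib, Finset.mul_sum,
        Finset.mul_sum]
      refine Finset.sum_congr rfl fun i _ => ?_
      rw [hres i]
      simp only [Pi.smul_apply, smul_eq_mul]
      field_simp
    simp only [Pi.smul_apply, Pi.sub_apply, smul_eq_mul, weightedScore]
    linarith
  have h1 : debias Θ z b (fun i => ω i / s) j - β₀ j = d j + (Θ *ᵥ c) j := by
    simp only [debias, Pi.add_apply, hd, Pi.sub_apply, hc]
    ring
  have h2 : s / n * (Θ *ᵥ c) j = (Θ *ᵥ weightedScore β₀ z ω) j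
      - (Θ *ᵥ (weightNoise z ω *ᵥ d)) j - ((Θ * OmegaHat z) *ᵥ d) j := by
    have : s / n * (Θ *ᵥ c) j = (Θ *ᵥ ((s / n) • c)) j := by
      rw [Matrix.mulVec_smul]; rfl
    rw [this, hcs, Matrix.mulVec_sub, Matrix.mulVec_sub, Matrix.mulVec_mulVec (M := Θ)
      (N := OmegaHat z)]
    rfl
  have h3 : (Θ₀ *ᵥ weightedScore β₀ z ω) j = (n : ℝ)⁻¹ * ∑ i, ω i * influence Θ₀ β₀ j (z i) := by
    simp only [Matrix.mulVec, dotProduct, weightedScore, influence]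
    simp_rw [Finset.mul_sum, Finset.sum_mul, Finset.mul_sum]
    rw [Finset.sum_comm]
    exact Finset.sum_congr rfl fun i _ => Finset.sum_congr rfl fun k _ => by ring
  rw [h1, mul_add, h2, Matrix.sub_mulVec, Matrix.sub_mulVec, Matrix.one_mulVec, Pi.sub_apply,
    Pi.sub_apply, h3]
  ring

lemma abs_debias_expansion_sub_le (Θ Θ₀ : Matrix (Fin p) (Fin p) ℝ) (β₀ b : Fin p → ℝ)
    (z : Sample n p) {ω : Fin n → ℝ} (hω : ∑ i, ω i ≠ 0) (j : Fin p) {e g d ρ τ : ℝ}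
    (hρ : 0 ≤ ρ) (he : l1Norm (b - β₀) ≤ e) (hg : maxNorm (Θ * OmegaHat z - 1) ≤ g)
    (hd : opNormInf (Θ - Θ₀) ≤ d) (hτ : |(∑ i, ω i) / n - 1| ≤ τ)
    (hs : ∀ k, |(n : ℝ)⁻¹ * ∑ i, (z i).2 k * err β₀ (z i)| ≤ ρ)
    (hw : ∀ k l, |(n : ℝ)⁻¹ * ∑ i, (ω i - 1) * (coordErr β₀ k (z i) * coordErr β₀ l (z i))| ≤ ρ) :
    |(∑ i, ω i) / n * (debias Θ z b (fun i => ω i / ∑ k, ω k) j - β₀ j)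
      - (n : ℝ)⁻¹ * ∑ i, ω i * influence Θ₀ β₀ j (z i)|
      ≤ τ * e + g * e + (opNormInf Θ₀ + d) * (ρ * e) + d * (2 * ρ) := by
  rw [debias_expansion Θ Θ₀ β₀ b z hω j, add_sub_cancel_left]
  have hl0 := l1Norm_nonneg (b - β₀)
  have he0 : 0 ≤ e := hl0.trans he
  have hτ0 : 0 ≤ τ := (abs_nonneg _).trans hτ
  have hg0 : 0 ≤ g := le_trans (norm_nonneg _) hg
  have hd0 : 0 ≤ d := le_trans (opNormInf_nonneg _) hd
  have t1 : |((∑ i, ω i) / n - 1) * (b - β₀) j| ≤ τ * e := by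
    rw [abs_mul]
    exact mul_le_mul hτ ((abs_le_l1Norm _ j).trans he) (abs_nonneg _) hτ0
  have t2 : |((Θ * OmegaHat z - 1) *ᵥ (b - β₀)) j| ≤ g * e :=
    (abs_mulVec_le_mul_l1Norm j (fun l => (abs_apply_le_maxNorm _ j l).trans hg) _).trans
      (mul_le_mul_of_nonneg_left he hg0)
  have t3 : |(Θ *ᵥ (weightNoise z ω *ᵥ (b - β₀))) j| ≤ (opNormInf Θ₀ + d) * (ρ * e) := by
    refine (abs_mulVec_le_opNormInf_mul Θ (c := ρ * e) (by positivity) (fun l => ?_) j).trans ?_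
    · refine (abs_mulVec_le_mul_l1Norm l (fun k => ?_) _).trans
        (mul_le_mul_of_nonneg_left he hρ)
      exact hw (some l) (some k)
    · gcongr
      exact (opNormInf_le_add_sub Θ Θ₀).trans (by gcongr)
  have t4 : |((Θ - Θ₀) *ᵥ weightedScore β₀ z ω) j| ≤ d * (2 * ρ) := by
    refine (abs_mulVec_le_opNormInf_mul _ (c := 2 * ρ) (by positivity) (fun l => ?_) j).trans
      (by gcongr)
    -- The unweighted score and its weight noise are each at most ρ, hence the factor 2.
    have e1 : weightedScore β₀ z ω l = (n : ℝ)⁻¹ * ∑ i, (z i).2 l * err β₀ (z i)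
        + (n : ℝ)⁻¹ * ∑ i, (ω i - 1) * (coordErr β₀ (some l) (z i) * coordErr β₀ none (z i)) := by
      rw [← mul_add, ← Finset.sum_add_distrib, weightedScore]
      congr 1
      refine Finset.sum_congr rfl fun i _ => ?_
      simp only [coordErr]
      ring
    rw [e1]
    refine (abs_add_le _ _).trans ?_
    linarith [hs l, hw (some l) none]
  have a1 := abs_le.1 t1
  have a2 := abs_le.1 t2
  have a3 := abs_le.1 t3
  have a4 := abs_le.1 t4
  exact abs_le.2 ⟨by linarith, by linarith⟩

end Expansion

/-! ### The conditional law of a coordinate of the debiased posterior -/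

section Conditional

variable {n p : ℕ}

/-- The law of the `j`th coordinate of the debiased posterior. -/
noncomputable def coordLaw (Post : Kernel (Sample n p) (Fin p → ℝ))
    (Θhat : Sample n p → Matrix (Fin p) (Fin p) ℝ) (z : Sample n p) (j : Fin p) : Measure ℝ :=
  (debiasedPosterior Post Θhat z).map fun b => b j

lemma measurable_debias (Θ : Matrix (Fin p) (Fin p) ℝ) (z : Sample n p) :
    Measurable fun bw : (Fin p → ℝ) × (Fin n → ℝ) => debias Θ z bw.1 bw.2 := by
  refine measurable_pi_lambda _ fun j => ?_
  simp only [debias, Pi.add_apply, Matrix.mulVec, dotProduct, Finset.sum_apply, Pi.smul_apply]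
  fun_prop

lemma measurable_bootstrapWeights :
    Measurable fun (ω : Fin n → ℝ) (i : Fin n) => ω i / ∑ k, ω k := by
  fun_prop

lemma measurable_debias_coord (Θ : Matrix (Fin p) (Fin p) ℝ) (z : Sample n p) (j : Fin p) :
    Measurable fun bω : (Fin p → ℝ) × (Fin n → ℝ) =>
      debias Θ z bω.1 (fun i => bω.2 i / ∑ k, bω.2 k) j := by
  have h : Measurable fun bω : (Fin p → ℝ) × (Fin n → ℝ) =>
      debias Θ z bω.1 (fun i => bω.2 i / ∑ k, bω.2 k) :=
    (measurable_debias Θ z).comp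
      (measurable_fst.prodMk (measurable_bootstrapWeights.comp measurable_snd))
  exact measurable_pi_iff.1 h j

/-- Writing the law over the unnormalized exponentials restores the independence that the central
limit theorem and Bernstein's inequality need. -/
lemma coordLaw_eq_map (Post : Kernel (Sample n p) (Fin p → ℝ)) [IsMarkovKernel Post]
    (Θhat : Sample n p → Matrix (Fin p) (Fin p) ℝ) (z : Sample n p) (j : Fin p) :
    coordLaw Post Θhat z j = ((Post z).prod (Measure.pi fun _ : Fin n => expMeasure 1)).map
      fun bω => debias (Θhat z) z bω.1 (fun i => bω.2 i / ∑ k, bω.2 k) j := by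
  have h1 : (Post z).prod (bootstrapLaw n)
      = ((Post z).prod (Measure.pi fun _ : Fin n => expMeasure 1)).map
        (Prod.map id fun (ω : Fin n → ℝ) (i : Fin n) => ω i / ∑ k, ω k) := by
    rw [← Measure.map_prod_map _ _ measurable_id measurable_bootstrapWeights, Measure.map_id]
    rfl
  rw [coordLaw, debiasedPosterior, h1,
    Measure.map_map (measurable_debias _ _) (measurable_id.prodMap measurable_bootstrapWeights),
    Measure.map_map (measurable_pi_apply j) ((measurable_debias _ _).comp
      (measurable_id.prodMap measurable_bootstrapWeights))]
  rfl

instance isProbabilityMeasure_coordLaw (Post : Kernel (Sample n p) (Fin p → ℝ))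
    [IsMarkovKernel Post] (Θhat : Sample n p → Matrix (Fin p) (Fin p) ℝ) (z : Sample n p)
    (j : Fin p) : IsProbabilityMeasure (coordLaw Post Θhat z j) := by
  rw [coordLaw_eq_map]
  exact Measure.isProbabilityMeasure_map (measurable_debias_coord _ _ _).aemeasurable

/-- Stated for arbitrary sets, so that no measurability of exceptional events has to be checked. -/
lemma prod_measureReal_fst_le {A B : Type*} [MeasurableSpace A] [MeasurableSpace B]
    (P : Measure A) (Q : Measure B) [IsProbabilityMeasure P] [IsProbabilityMeasure Q] (s : Set A) :
    (P.prod Q).real {x | x.1 ∈ s} ≤ P.real s :=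
  ENNReal.toReal_mono (measure_ne_top _ _)
    ((measurePreserving_fst (μ := P) (ν := Q)).measure_preimage_le s)

lemma prod_measureReal_snd_le {A B : Type*} [MeasurableSpace A] [MeasurableSpace B]
    (P : Measure A) (Q : Measure B) [IsProbabilityMeasure P] [IsProbabilityMeasure Q] (s : Set B) :
    (P.prod Q).real {x | x.2 ∈ s} ≤ Q.real s :=
  ENNReal.toReal_mono (measure_ne_top _ _)
    ((measurePreserving_snd (μ := P) (ν := Q)).measure_preimage_le s)

lemma prod_measureReal_snd {A B : Type*} [MeasurableSpace A] [MeasurableSpace B]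
    (P : Measure A) (Q : Measure B) [IsProbabilityMeasure P] [IsProbabilityMeasure Q] {s : Set B}
    (hs : MeasurableSet s) : (P.prod Q).real {x | x.2 ∈ s} = Q.real s :=
  congrArg ENNReal.toReal
    ((measurePreserving_snd (μ := P) (ν := Q)).measure_preimage hs.nullMeasurableSet)

/-- Off small events, the distribution function of the debiased posterior at the true parameter is
the one of the weighted bootstrap sum, up to a small shift. -/
lemma coordLaw_cdf_compare (Post : Kernel (Sample n p) (Fin p → ℝ)) [IsMarkovKernel Post]
    (Θhat : Sample n p → Matrix (Fin p) (Fin p) ℝ) (z : Sample n p) (j : Fin p)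
    (Θ₀ : Matrix (Fin p) (Fin p) ℝ) (β₀ : Fin p → ℝ) (hn : 0 < n)
    {σ e g d ρ τ η κ : ℝ} (hσ : 0 < σ) (hρ : 0 ≤ ρ) (hτ1 : τ < 1)
    (hP : (Post z).real {b | e ≤ l1Norm (b - β₀)} ≤ κ)
    (hg : maxNorm (Θhat z * OmegaHat z - 1) ≤ g) (hd : opNormInf (Θhat z - Θ₀) ≤ d)
    (hs : ∀ k, |(n : ℝ)⁻¹ * ∑ i, (z i).2 k * err β₀ (z i)| ≤ ρ)
    (hw : (Measure.pi fun _ : Fin n => expMeasure 1).real {ω | ∃ k l, ρ <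
      |(n : ℝ)⁻¹ * ∑ i, (ω i - 1) * (coordErr β₀ k (z i) * coordErr β₀ l (z i))|} ≤ κ)
    (hτ : (Measure.pi fun _ : Fin n => expMeasure 1).real {ω | τ < |(∑ i, ω i) / n - 1|} ≤ κ)
    (hη : √n / σ * (τ * e + g * e + (opNormInf Θ₀ + d) * (ρ * e) + d * (2 * ρ)) < η) :
    (∀ x, -(∑ i, influence Θ₀ β₀ j (z i) / (σ * √n)) + η ≤ x →
      (coordLaw Post Θhat z j).real (Set.Iic (β₀ j)) ≤
        (Measure.pi fun _ : Fin n => expMeasure 1).real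
          {ω | ∑ i, influence Θ₀ β₀ j (z i) / (σ * √n) * (ω i - 1) ≤ x} + 3 * κ) ∧
    (∀ x, x ≤ -(∑ i, influence Θ₀ β₀ j (z i) / (σ * √n)) - η →
      (Measure.pi fun _ : Fin n => expMeasure 1).real
          {ω | ∑ i, influence Θ₀ β₀ j (z i) / (σ * √n) * (ω i - 1) ≤ x} ≤
        (coordLaw Post Θhat z j).real (Set.Iio (β₀ j)) + 3 * κ) := by
  have hn' : (0 : ℝ) < n := Nat.cast_pos.2 hn
  have hR : 0 < √(n : ℝ) := Real.sqrt_pos.2 hn'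
  set W := Measure.pi fun _ : Fin n => expMeasure 1 with hW
  set S := ∑ i, influence Θ₀ β₀ j (z i) / (σ * √n) with hS
  set N1 : Set (Fin p → ℝ) := {b | e ≤ l1Norm (b - β₀)} with hN1
  set N2 : Set (Fin n → ℝ) := {ω | ∃ k l, ρ <
      |(n : ℝ)⁻¹ * ∑ i, (ω i - 1) * (coordErr β₀ k (z i) * coordErr β₀ l (z i))|} with hN2
  set N3 : Set (Fin n → ℝ) := {ω | τ < |(∑ i, ω i) / n - 1|} with hN3
  -- Its three parts are a draw far from β₀, large weight noise and an atypical mean weight; they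
  -- produce the 3 κ. Off the last one τ < 1 forces a positive sum of weights.
  set N : Set ((Fin p → ℝ) × (Fin n → ℝ)) := {x | x.1 ∈ N1} ∪ {x | x.2 ∈ N2} ∪ {x | x.2 ∈ N3}
    with hN
  have hNle : ((Post z).prod W).real N ≤ 3 * κ := by
    refine (measureReal_union_le _ _).trans ((add_le_add ((measureReal_union_le _ _).trans
      (add_le_add ((prod_measureReal_fst_le _ _ _).trans hP)
        ((prod_measureReal_snd_le _ _ _).trans hw)))
      ((prod_measureReal_snd_le _ _ _).trans hτ)).trans (by linarith))
  have key : ∀ x : (Fin p → ℝ) × (Fin n → ℝ), x ∉ N → 0 < ∑ i, x.2 i ∧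
      |√n / σ * ((∑ i, x.2 i) / n * (debias (Θhat z) z x.1 (fun i => x.2 i / ∑ k, x.2 k) j - β₀ j))
        - (∑ i, influence Θ₀ β₀ j (z i) / (σ * √n) * (x.2 i - 1) + S)| < η := by
    intro x hx
    simp only [hN, hN1, hN2, hN3, Set.mem_union, Set.mem_ofPred_eq, not_or, not_exists, not_le,
      not_lt] at hx
    obtain ⟨⟨h1, h2⟩, h3⟩ := hx
    have hpos : 0 < ∑ i, x.2 i := by
      have := (abs_le.1 h3).1
      have h4 : 0 < (∑ i, x.2 i) / n := by linarith
      exact (div_pos_iff_of_pos_right hn').1 h4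
    refine ⟨hpos, ?_⟩
    have hb := abs_debias_expansion_sub_le (Θhat z) Θ₀ β₀ x.1 z hpos.ne' j hρ h1.le hg hd h3 hs h2
    have e1 : ∑ i, influence Θ₀ β₀ j (z i) / (σ * √n) * (x.2 i - 1) + S
        = √n / σ * ((n : ℝ)⁻¹ * ∑ i, x.2 i * influence Θ₀ β₀ j (z i)) := by
      rw [hS, ← Finset.sum_add_distrib, Finset.mul_sum, Finset.mul_sum]
      refine Finset.sum_congr rfl fun i _ => ?_
      have e2 : (n : ℝ)⁻¹ = (√n)⁻¹ * (√n)⁻¹ := by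
        rw [← mul_inv, Real.mul_self_sqrt hn'.le]
      rw [e2]
      field_simp
      ring
    rw [e1, ← mul_sub, abs_mul, abs_of_pos (div_pos hR hσ)]
    exact (mul_le_mul_of_nonneg_left hb (div_pos hR hσ).le).trans_lt hη
  have hTm : ∀ x : ℝ, MeasurableSet
      {ω : Fin n → ℝ | ∑ i, influence Θ₀ β₀ j (z i) / (σ * √n) * (ω i - 1) ≤ x} := fun x =>
    measurableSet_le (by fun_prop) measurable_const
  rw [coordLaw_eq_map, map_measureReal_apply (measurable_debias_coord _ _ _) measurableSet_Iic,
    map_measureReal_apply (measurable_debias_coord _ _ _) measurableSet_Iio]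
  constructor
  · intro x hx
    rw [← prod_measureReal_snd (Post z) W (hTm x)]
    refine le_trans (measureReal_mono (fun y hy => ?_))
      ((measureReal_union_le _ N).trans (add_le_add_right hNle _))
    by_cases hyN : y ∈ N
    · exact Or.inr hyN
    · refine Or.inl ?_
      obtain ⟨hp, hk⟩ := key y hyN
      have hy' : debias (Θhat z) z y.1 (fun i => y.2 i / ∑ k, y.2 k) j ≤ β₀ j := hy
      -- The positive factors preserve the sign of the error of the draw, so the normalization of
      -- the weights does not affect the event.
      have h1 : √n / σ * ((∑ i, y.2 i) / n *
          (debias (Θhat z) z y.1 (fun i => y.2 i / ∑ k, y.2 k) j - β₀ j)) ≤ 0 :=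
        mul_nonpos_of_nonneg_of_nonpos (by positivity)
          (mul_nonpos_of_nonneg_of_nonpos (by positivity) (by linarith))
      have h2 := (abs_lt.1 hk).1
      simp only [Set.mem_ofPred_eq]
      linarith
  · intro x hx
    rw [← prod_measureReal_snd (Post z) W (hTm x)]
    refine le_trans (measureReal_mono (fun y hy => ?_))
      ((measureReal_union_le _ N).trans (add_le_add_right hNle _))
    by_cases hyN : y ∈ N
    · exact Or.inr hyN
    · refine Or.inl ?_
      obtain ⟨hp, hk⟩ := key y hyN
      simp only [Set.mem_ofPred_eq] at hy
      change debias (Θhat z) z y.1 (fun i => y.2 i / ∑ k, y.2 k) j < β₀ j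
      by_contra! hcon
      have h1 : 0 ≤ √n / σ * ((∑ i, y.2 i) / n *
          (debias (Θhat z) z y.1 (fun i => y.2 i / ∑ k, y.2 k) j - β₀ j)) :=
        mul_nonneg (by positivity) (mul_nonneg (by positivity) (by linarith))
      have h2 := (abs_lt.1 hk).2
      linarith

end Conditional

lemma exists_pi_expMeasure_mean_bound {κ : ℝ} (hκ : 0 < κ) :
    ∃ C : ℝ, 0 < C ∧ ∀ n : ℕ, 0 < n → (Measure.pi fun _ : Fin n => expMeasure 1).real
      {ω | C / √n < |(∑ i, ω i) / n - 1|} ≤ κ := by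
  set h := 2 / κ with hh
  have hh0 : 0 < h := by positivity
  have hexp : 2 * Real.exp (-h) ≤ κ := by
    have h1 := Real.add_one_le_exp h
    rw [Real.exp_neg, ← div_eq_mul_inv, div_le_iff₀ (Real.exp_pos h)]
    have : κ * h = 2 := by rw [hh]; field_simp
    nlinarith
  have hs0 : 0 < √h := Real.sqrt_pos.2 hh0
  refine ⟨32 * √h + 16 * h, by positivity, fun n hn => ?_⟩
  have hn' : (0 : ℝ) < n := Nat.cast_pos.2 hn
  have hR : 0 < √(n : ℝ) := Real.sqrt_pos.2 hn'
  have hb := pi_expMeasure_abs_sum_sub_one_mul_ge_le (fun _ : Fin n => (1 : ℝ)) (v := n) (B := 1)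
    (t := h) hn' one_pos hh0.le (by simp) (by simp)
  refine le_trans (measureReal_mono fun ω hω => ?_) (hb.trans hexp)
  simp only [Set.mem_ofPred_eq] at hω ⊢
  have e1 : (∑ i, ω i) / n - 1 = (∑ i, (ω i - 1) * 1) / n := by
    simp only [mul_one, Finset.sum_sub_distrib, Finset.sum_const, Finset.card_univ,
      Fintype.card_fin, nsmul_eq_mul]
    field_simp
  rw [e1, abs_div, abs_of_pos hn', div_lt_div_iff₀ hR hn'] at hω
  have hRR : √(n : ℝ) * √n = n := Real.mul_self_sqrt hn'.le
  -- This lets the linear Bernstein term 16 h be absorbed into 16 h √n.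
  have h1R : 1 ≤ √(n : ℝ) := Real.one_le_sqrt.2 (by exact_mod_cast hn)
  rw [Real.sqrt_mul hn'.le]
  have h3 : (32 * √h + 16 * h) * √n < |∑ i, (ω i - 1) * 1| := by
    by_contra! hcon
    have h4 := mul_le_mul_of_nonneg_right hcon hR.le
    rw [mul_assoc, hRR] at h4
    linarith
  nlinarith

/-! ### Moments of the influence -/

section Influence

variable {p : ℕ} {μ : Measure (Obs p)} {β₀ : Fin p → ℝ} {K : ℝ}

lemma influence_eq_sum (Θ : Matrix (Fin p) (Fin p) ℝ) (j : Fin p) (z : Obs p) :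
    influence Θ β₀ j z = ∑ k, Θ j k * (z.2 k * err β₀ z) := by
  simp only [influence, Matrix.mulVec, dotProduct, Finset.sum_mul]
  exact Finset.sum_congr rfl fun k _ => by ring

lemma integral_influence (hU : ∀ k, ExpSqBound μ (coordErr β₀ k) K) (hK : 0 < K)
    (h0 : ∀ k, ∫ z, z.2 k * err β₀ z ∂μ = 0) (Θ : Matrix (Fin p) (Fin p) ℝ) (j : Fin p) :
    ∫ z, influence Θ β₀ j z ∂μ = 0 := by
  simp_rw [influence_eq_sum]
  have hi : ∀ k, Integrable (fun z : Obs p => z.2 k * err β₀ z) μ := fun k =>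
    (hU (some k)).integrable_mul (hU none) hK (measurable_coordErr β₀ (some k))
      (measurable_coordErr β₀ none)
  rw [integral_finsetSum _ fun k _ => (hi k).const_mul _]
  simp_rw [integral_const_mul, h0]
  simp

/-- The square is expanded as a quadratic form in row j of Θ₀, and symmetry of Θ₀ identifies that
row with the column. Fourth moments give integrability through |x y w²| ≤ x⁴ + y⁴ + w⁴. -/
lemma integral_influence_sq (hU : ∀ k, ExpSqBound μ (coordErr β₀ k) K) (hK : 0 < K)
    (j : Fin p) : ∫ z, influence (Theta0 μ) β₀ j z ^ 2 ∂μ = sigmaSq μ β₀ j := by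
  have hm := measurable_coordErr β₀
  have hi : ∀ k l, Integrable (fun z : Obs p => z.2 k * z.2 l * err β₀ z ^ 2) μ := by
    intro k l
    have i4 := fun k => (hU k).integrable_pow_four hK (hm k)
    have hme := measurable_err β₀
    refine (((i4 (some k)).add (i4 (some l))).add (i4 none)).mono' (by fun_prop)
      (ae_of_all _ fun z => ?_)
    simp only [Pi.add_apply, coordErr, Real.norm_eq_abs]
    generalize z.2 k = x
    generalize z.2 l = y
    generalize err β₀ z = w
    refine abs_le.2 ⟨?_, ?_⟩
    · nlinarith [sq_nonneg (x * y + w ^ 2), sq_nonneg (x ^ 2 - y ^ 2), sq_nonneg (x ^ 2),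
        sq_nonneg (y ^ 2), sq_nonneg (w ^ 2)]
    · nlinarith [sq_nonneg (x * y - w ^ 2), sq_nonneg (x ^ 2 - y ^ 2), sq_nonneg (x ^ 2),
        sq_nonneg (y ^ 2), sq_nonneg (w ^ 2)]
  have hsymm : (Theta0 μ)ᵀ = Theta0 μ := by
    have : (Omega0 μ)ᵀ = Omega0 μ := by
      ext k l
      simp only [Omega0, Matrix.transpose_apply, Matrix.of_apply, mul_comm]
    rw [Theta0, Matrix.transpose_nonsing_inv, this]
  have e1 : ∀ z : Obs p, influence (Theta0 μ) β₀ j z ^ 2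
      = ∑ l, ∑ k, Theta0 μ j k * Theta0 μ j l * (z.2 k * z.2 l * err β₀ z ^ 2) := by
    intro z
    rw [influence_eq_sum, sq, Finset.sum_mul_sum, Finset.sum_comm]
    exact Finset.sum_congr rfl fun l _ => Finset.sum_congr rfl fun k _ => by ring
  simp_rw [e1]
  rw [integral_finsetSum _ fun l _ => integrable_finsetSum _ fun k _ => (hi k l).const_mul _]
  simp only [sigmaSq, Matrix.mul_apply, Finset.sum_mul]
  refine Finset.sum_congr rfl fun l _ => ?_
  rw [integral_finsetSum _ fun k _ => (hi k l).const_mul _]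
  refine Finset.sum_congr rfl fun k _ => ?_
  rw [integral_const_mul, scoreCov, Matrix.of_apply]
  have : Theta0 μ l j = Theta0 μ j l := by
    conv_lhs => rw [← hsymm, Matrix.transpose_apply]
  rw [this]
  ring

lemma integrable_influence_cube {Θ : Matrix (Fin p) (Fin p) ℝ} {j : Fin p} {M : ℝ}
    (h : ∫⁻ z, ENNReal.ofReal (|(Θ *ᵥ z.2) j * err β₀ z| ^ 3) ∂μ ≤ ENNReal.ofReal M) :
    Integrable (fun z => |influence Θ β₀ j z| ^ 3) μ ∧
      ∫ z, |influence Θ β₀ j z| ^ 3 ∂μ ≤ max M 0 := by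
  have hm : Measurable fun z => |influence Θ β₀ j z| ^ 3 := by
    have := measurable_influence Θ β₀ j
    fun_prop
  have h0 : 0 ≤ᵐ[μ] fun z => |influence Θ β₀ j z| ^ 3 := ae_of_all _ fun z => by positivity
  constructor
  · refine ⟨hm.aestronglyMeasurable, ?_⟩
    rw [hasFiniteIntegral_iff_ofReal h0]
    exact lt_of_le_of_lt h ENNReal.ofReal_lt_top
  · rw [integral_eq_lintegral_of_nonneg_ae h0 hm.aestronglyMeasurable]
    refine ENNReal.toReal_le_of_le_ofReal (le_max_right _ _) (h.trans ?_)
    exact ENNReal.ofReal_le_ofReal (le_max_left _ _)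

end Influence

/-! ### Central limit theorems for the data and for the bootstrap weights -/

lemma tendsto_const_div_sqrt_nat (c : ℝ) : Tendsto (fun n : ℕ => c / √(n : ℝ)) atTop (𝓝 0) :=
  (Real.tendsto_sqrt_atTop.comp tendsto_natCast_atTop_atTop).const_div_atTop c

/-- The threshold for n depends on the law only through M, so the law may change with n. All weights
equal 1 / √n, with sum of cubes 1 / √n. -/
lemma eventually_normalized_sum_cdf_close (x M : ℝ) {κ : ℝ} (hκ : 0 < κ) :
    ∀ᶠ n : ℕ in atTop, ∀ {E : Type} [MeasurableSpace E] (ν : Measure E) [IsProbabilityMeasure ν]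
      (D : E → ℝ), Measurable D → Integrable (fun x => |D x| ^ 3) ν → ∫ x, |D x| ^ 3 ∂ν ≤ M →
      ∫ x, D x ∂ν = 0 → ∫ x, D x ^ 2 ∂ν = 1 →
      |(Measure.pi fun _ : Fin n => ν).real {z | ∑ i, D (z i) / √n ≤ x}
        - (gaussianReal 0 1).real (Set.Iic x)| ≤ κ := by
  obtain ⟨δ, hδ, h⟩ := exists_lyapunov_imp_cdf_close x hκ
  filter_upwards [(tendsto_const_div_sqrt_nat (4 * M + 1)).eventually_lt_const hδ,
    eventually_gt_atTop 0] with n hn hn0 E _ ν _ D hD h3 hM h1 h2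
  have hn' : (0 : ℝ) < n := Nat.cast_pos.2 hn0
  have hR : 0 < √(n : ℝ) := Real.sqrt_pos.2 hn'
  have hRR : √(n : ℝ) * √n = n := Real.mul_self_sqrt hn'.le
  have := h ν D hD h3 h1 h2 n (fun _ => (√(n : ℝ))⁻¹) ?_ ?_
  · simpa only [div_eq_inv_mul] using this
  · simp only [Finset.sum_const, Finset.card_univ, Fintype.card_fin, nsmul_eq_mul, inv_pow,
      Real.sq_sqrt hn'.le, mul_inv_cancel₀ hn'.ne', sub_self, abs_zero]
    exact hδ.le
  · simp only [Finset.sum_const, Finset.card_univ, Fintype.card_fin, nsmul_eq_mul,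
      abs_of_pos (inv_pos.2 hR)]
    have e : (n : ℝ) * (√n)⁻¹ ^ 3 = 1 / √n := by
      nth_rewrite 1 [← hRR]
      field_simp
    rw [e, mul_one_div]
    refine le_trans ?_ hn.le
    gcongr

/-- The roles are exchanged: the i.i.d. variables are ω_i - 1 and the data enter as the
deterministic weights D (z i) / √n. Their squares sum to nearly 1 by the weak law for squares, and
their cubes are small by Markov's inequality, each with high probability. -/
lemma eventually_bootstrap_sum_cdf_close (x M : ℝ) {κ : ℝ} (hκ : 0 < κ) :
    ∀ᶠ n : ℕ in atTop, ∀ {E : Type} [MeasurableSpace E] (ν : Measure E) [IsProbabilityMeasure ν]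
      (D : E → ℝ), Measurable D → Integrable (fun x => |D x| ^ 3) ν → ∫ x, |D x| ^ 3 ∂ν ≤ M →
      ∫ x, D x ^ 2 ∂ν = 1 →
      (Measure.pi fun _ : Fin n => ν).real {z | ¬ |(Measure.pi fun _ : Fin n => expMeasure 1).real
          {ω | ∑ i, D (z i) / √n * (ω i - 1) ≤ x} - (gaussianReal 0 1).real (Set.Iic x)| ≤ κ}
        ≤ κ := by
  obtain ⟨δ, hδ, h⟩ := exists_lyapunov_imp_cdf_close x hκ
  set ρ := 4 * ∫ x, |x - 1| ^ 3 ∂(expMeasure 1) + 1 with hρ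
  have hρ0 : 0 < ρ := by
    have : 0 ≤ ∫ x, |x - 1| ^ 3 ∂(expMeasure 1) := integral_nonneg fun x => by positivity
    linarith
  filter_upwards [(tendsto_const_div_sqrt_nat (4 * M)).eventually_lt_const hδ,
    (tendsto_const_div_sqrt_nat ((4 / δ ^ 2 + 4 / δ) * M)).eventually_lt_const (half_pos hκ),
    (tendsto_const_div_sqrt_nat (M * ρ / δ)).eventually_lt_const (half_pos hκ),
    eventually_gt_atTop 0] with n hn1 hn2 hn3 hn0 E _ ν _ D hD h3 hM h2
  have hn' : (0 : ℝ) < n := Nat.cast_pos.2 hn0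
  have hR : 0 < √(n : ℝ) := Real.sqrt_pos.2 hn'
  have hRR : √(n : ℝ) * √n = n := Real.mul_self_sqrt hn'.le
  have b1 := pi_measureReal_abs_sum_sq_sub_ge_le hD h3 h2 hM hδ hn0
    ((div_lt_iff₀ hR).1 hn1).le
  have b2 := pi_measureReal_sum_ge_le_div h3 (fun x => by positivity)
    (c := δ * (n * √n) / ρ) (by positivity) n
  have b2' : (n : ℝ) * (∫ x, |D x| ^ 3 ∂ν) / (δ * (n * √n) / ρ) ≤ M * ρ / δ / √n := by
    calc (n : ℝ) * (∫ x, |D x| ^ 3 ∂ν) / (δ * (n * √n) / ρ) ≤ n * M / (δ * (n * √n) / ρ) := by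
          gcongr
      _ = _ := by field_simp
  refine (measureReal_mono (fun z hz => ?_)).trans ((measureReal_union_le _ _).trans
    ((add_le_add (b1.trans hn2.le) (b2.trans (b2'.trans hn3.le))).trans (by linarith)))
  by_contra hcon
  simp only [Set.mem_union, Set.mem_ofPred_eq, not_or, not_le] at hcon hz
  obtain ⟨g1, g2⟩ := hcon
  have := h (expMeasure 1) (fun x => x - 1) (by fun_prop)
    integrable_expMeasure_one_abs_sub_one_cube integral_expMeasure_one_sub_one
    integral_expMeasure_one_sub_one_sq n (fun i => D (z i) / √n) ?_ ?_
  · exact absurd this (not_le.2 hz)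
  · have e : ∑ i, (D (z i) / √n) ^ 2 - 1 = (∑ i, D (z i) ^ 2 - n) / n := by
      simp_rw [div_pow, Real.sq_sqrt hn'.le]
      rw [← Finset.sum_div, sub_div, div_self hn'.ne']
    rw [e, abs_div, abs_of_pos hn', div_le_iff₀ hn']
    linarith
  · have e : ∑ i, |D (z i) / √n| ^ 3 = (∑ i, |D (z i)| ^ 3) / (n * √n) := by
      rw [Finset.sum_div]
      refine Finset.sum_congr rfl fun i _ => ?_
      rw [abs_div, abs_of_pos hR, div_pow]
      congr 1
      nth_rewrite 2 [← hRR]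
      ring
    rw [e, ← hρ, ← mul_div_assoc, div_le_iff₀ (by positivity)]
    rw [lt_div_iff₀ hρ0] at g2
    linarith

/-! ### Coverage -/

/-- Coverage of an equal-tailed quantile interval in terms of bounds on the distribution function
at the point to be covered. -/
lemma mem_Icc_quantile_of_cdf_bounds {ν : Measure ℝ} [IsProbabilityMeasure ν] {G Φ : ℝ → ℝ}
    {y V η κ α a b : ℝ} (hα0 : 0 < α) (hα1 : α < 1)
    (hup : ∀ x, V + η ≤ x → ν.real (Set.Iic y) ≤ G x + 3 * κ)
    (hlow : ∀ x, x ≤ V - η → G x ≤ ν.real (Set.Iio y) + 3 * κ)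
    (h1 : |G (a + η) - Φ (a + η)| ≤ κ) (h2 : |G (a - η) - Φ (a - η)| ≤ κ)
    (h3 : |G (b + η) - Φ (b + η)| ≤ κ) (h4 : |G (b - η) - Φ (b - η)| ≤ κ)
    (g1 : α / 2 + 4 * κ < Φ (a + η)) (g2 : Φ (a - η) + 4 * κ < α / 2)
    (g3 : 1 - α / 2 + 4 * κ < Φ (b + η)) (g4 : Φ (b - η) + 4 * κ < 1 - α / 2) :
    (a + 2 * η ≤ V → V ≤ b - 2 * η →
      y ∈ Set.Icc (quantile ν (α / 2)) (quantile ν (1 - α / 2))) ∧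
    (y ∈ Set.Icc (quantile ν (α / 2)) (quantile ν (1 - α / 2)) →
      a - 2 * η ≤ V ∧ V ≤ b + 2 * η) := by
  rw [abs_le] at h1 h2 h3 h4
  refine ⟨fun ha hb => ⟨?_, ?_⟩, fun hy => ⟨?_, ?_⟩⟩
  -- Here as in the other three cases the margin 4 κ is spent as 3 κ on the comparison with G and κ
  -- on the normal approximation.
  · refine quantile_le_of_le (by linarith) ?_
    have := hlow (a + η) (by linarith)
    have h5 : ν.real (Set.Iio y) ≤ ν.real (Set.Iic y) := measureReal_mono Set.Iio_subset_Iic_self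
    linarith
  · refine (lt_quantile_of_lt (by linarith) ?_).le
    have := hup (b - η) (by linarith)
    linarith
  · by_contra! hcon
    have := hup (a - η) (by linarith)
    exact absurd (lt_quantile_of_lt (ν := ν) (τ := α / 2) (y := y) (by linarith) (by linarith))
      (not_lt.2 hy.1)
  · by_contra! hcon
    have := hlow (b + η) (by linarith)
    exact absurd (quantile_lt_of_lt (ν := ν) (τ := 1 - α / 2) (y := y) (by linarith)
      (by linarith)) (not_lt.2 hy.2)

/-- A sandwich between events about an asymptotically normal variable bounds the probability of
the event in between. -/
lemma abs_measureReal_sub_le_of_sandwich {Ω : Type*} [MeasurableSpace Ω] {P : Measure Ω}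
    [IsProbabilityMeasure P] {V : Ω → ℝ} (hV : Measurable V) {Φ : ℝ → ℝ} {Cov Bad : Set Ω}
    {a b η κ c q e : ℝ} (hη : 0 < η) (hbad : P.real Bad ≤ q)
    (hcov : ∀ z, z ∉ Bad → (a + 2 * η ≤ V z → V z ≤ b - 2 * η → z ∈ Cov) ∧
      (z ∈ Cov → a - 2 * η ≤ V z ∧ V z ≤ b + 2 * η))
    (h1 : |P.real {z | V z ≤ a + 2 * η} - Φ (a + 2 * η)| ≤ κ)
    (h2 : |P.real {z | V z ≤ b - 2 * η} - Φ (b - 2 * η)| ≤ κ)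
    (h3 : |P.real {z | V z ≤ a - 3 * η} - Φ (a - 3 * η)| ≤ κ)
    (h4 : |P.real {z | V z ≤ b + 2 * η} - Φ (b + 2 * η)| ≤ κ)
    (hab : a - 3 * η ≤ b + 2 * η)
    (g1 : c - e ≤ Φ (b - 2 * η) - Φ (a + 2 * η)) (g2 : Φ (b + 2 * η) - Φ (a - 3 * η) ≤ c + e) :
    |P.real Cov - c| ≤ e + 2 * κ + q := by
  rw [abs_le] at h1 h2 h3 h4
  have lower : P.real {z | V z ≤ b - 2 * η} ≤ P.real {z | V z ≤ a + 2 * η} + P.real Cov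
      + P.real Bad := by
    refine (measureReal_mono (fun z hz => ?_)).trans ((measureReal_union_le _ _).trans
      (add_le_add_left (measureReal_union_le _ _) _))
    by_cases hb : z ∈ Bad
    · exact Or.inr hb
    · refine Or.inl ?_
      rcases le_total (V z) (a + 2 * η) with h | h
      · exact Or.inl h
      · exact Or.inr ((hcov z hb).1 h hz)
  -- Coverage gives only a - 2 η ≤ V; the further η makes the removed event disjoint from it while
  -- keeping a closed half-line.
  have upper : P.real Cov + P.real {z | V z ≤ a - 3 * η} ≤ P.real {z | V z ≤ b + 2 * η}
      + P.real Bad := by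
    have hm : MeasurableSet {z | V z ≤ a - 3 * η} := measurableSet_le hV measurable_const
    have hsub : Cov ⊆ ({z | V z ≤ b + 2 * η} \ {z | V z ≤ a - 3 * η}) ∪ Bad := by
      intro z hz
      by_cases hb : z ∈ Bad
      · exact Or.inr hb
      · obtain ⟨h5, h6⟩ := (hcov z hb).2 hz
        refine Or.inl ⟨h6, fun h7 => ?_⟩
        rw [Set.mem_ofPred_eq] at h7
        linarith
    have h5 := (measureReal_mono (μ := P) hsub).trans (measureReal_union_le _ _)
    have hs : {z | V z ≤ a - 3 * η} ⊆ {z | V z ≤ b + 2 * η} := fun z hz => le_trans hz hab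
    rw [measureReal_sdiff hs hm] at h5
    linarith
  exact abs_le.2 ⟨by linarith, by linarith⟩

/-! ### Asymptotics of the remainder and of the exceptional events -/

/-- The total remainder in the expansion of the debiased posterior is asymptotically negligible. -/
lemma eventually_remainder_lt {σ e g d θ r : ℕ → ℝ} {c C₁ C₂ C₃ C₄ C₅ η : ℝ} (hc : 0 < c)
    (hσ : ∀ n, c ≤ σ n) (he0 : ∀ n, 0 < e n) (hd0 : ∀ n, 0 < d n)
    (hθ0 : ∀ n, 0 ≤ θ n) (hr0 : ∀ n, 0 ≤ r n)
    (h1 : 0 < C₁) (h2 : 0 < C₂) (h4 : 0 < C₄) (h5 : 0 < C₅) (hη : 0 < η)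
    (he : Tendsto e atTop (𝓝 0)) (heg : Tendsto (fun n : ℕ => √(n : ℝ) * e n * g n) atTop (𝓝 0))
    (hr : Tendsto (fun n : ℕ => √(n : ℝ) * (e n * θ n + d n) * r n) atTop (𝓝 0)) :
    ∀ᶠ n : ℕ in atTop, √(n : ℝ) / σ n * (C₁ / √n * (C₂ * e n) + (C₃ * g n) * (C₂ * e n)
      + (θ n + C₄ * d n) * ((C₅ * r n) * (C₂ * e n)) + (C₄ * d n) * (2 * (C₅ * r n))) < η := by
  -- A majorant of √n times the remainder in terms of the given rates. The product d · r · e is at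
  -- most e times the second rate, hence the fourth summand.
  have hlim : Tendsto (fun n : ℕ => C₁ * C₂ * e n + C₃ * C₂ * (√(n : ℝ) * e n * g n)
      + C₅ * C₂ * (√(n : ℝ) * (e n * θ n + d n) * r n)
      + C₄ * C₅ * C₂ * (e n * (√(n : ℝ) * (e n * θ n + d n) * r n))
      + 2 * (C₄ * C₅) * (√(n : ℝ) * (e n * θ n + d n) * r n)) atTop (𝓝 0) := by
    have := ((((he.const_mul (C₁ * C₂)).add (heg.const_mul (C₃ * C₂))).add
      (hr.const_mul (C₅ * C₂))).add ((he.mul hr).const_mul (C₄ * C₅ * C₂))).add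
      (hr.const_mul (2 * (C₄ * C₅)))
    simpa using this
  filter_upwards [hlim.eventually_lt_const (mul_pos hη hc), eventually_gt_atTop 0] with n hn hn0
  have hn' : (0 : ℝ) < n := Nat.cast_pos.2 hn0
  have hR : 0 < √(n : ℝ) := Real.sqrt_pos.2 hn'
  have hσ0 : 0 < σ n := hc.trans_le (hσ n)
  have e0 := he0 n
  have d0 := hd0 n
  have θ0 := hθ0 n
  have r0 := hr0 n
  rw [div_mul_eq_mul_div, div_lt_iff₀ hσ0]
  refine lt_of_lt_of_le (lt_of_le_of_lt ?_ hn) (mul_le_mul_of_nonneg_left (hσ n) hη.le)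
  have k1 : √(n : ℝ) * (C₁ / √n * (C₂ * e n)) = C₁ * C₂ * e n := by field_simp
  have p1 : 0 ≤ C₅ * C₂ * (√(n : ℝ) * d n * r n) := by positivity
  have p2 : 0 ≤ C₄ * C₅ * C₂ * (e n * (√(n : ℝ) * (e n * θ n) * r n)) := by positivity
  have p3 : 0 ≤ 2 * (C₄ * C₅) * (√(n : ℝ) * (e n * θ n) * r n) := by positivity
  rw [mul_add, mul_add, mul_add, k1]
  linarith

lemma measurableSet_le_l1Norm {p : ℕ} (β₀ : Fin p → ℝ) (c : ℝ) :
    MeasurableSet {b | c ≤ l1Norm (b - β₀)} := by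
  refine measurableSet_le measurable_const ?_
  simp only [l1Norm, Pi.sub_apply]
  fun_prop

/-- Markov's inequality for the random posterior mass: a mean of at most κ² leaves probability at
most κ of exceeding κ. -/
lemma measureReal_kernel_gt_le {A B : Type*} [MeasurableSpace A] [MeasurableSpace B]
    {P : Measure A} [IsProbabilityMeasure P] (k : Kernel A B) [IsMarkovKernel k] {s : Set B}
    (hs : MeasurableSet s) {κ : ℝ} (hκ : 0 < κ)
    (h : ∫⁻ z, k z s ∂P ≤ ENNReal.ofReal (κ * κ)) :
    P.real {z | ¬ (k z).real s ≤ κ} ≤ κ := by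
  have h1 := mul_meas_ge_le_lintegral (μ := P) (k.measurable_coe hs) (ENNReal.ofReal κ)
  have h2 : P {z | ¬ (k z).real s ≤ κ} ≤ P {z | ENNReal.ofReal κ ≤ k z s} := by
    refine measure_mono fun z hz => ?_
    simp only [Set.mem_ofPred_eq, not_le] at hz ⊢
    rw [ENNReal.ofReal_le_iff_le_toReal (measure_ne_top _ _)]
    exact hz.le
  have h3 : ENNReal.ofReal κ * P {z | ¬ (k z).real s ≤ κ} ≤ ENNReal.ofReal (κ * κ) :=
    (mul_le_mul_right h2 _).trans (h1.trans h)
  rw [ENNReal.ofReal_mul hκ.le, ENNReal.mul_le_mul_iff_right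
    (ENNReal.ofReal_pos.2 hκ).ne' ENNReal.ofReal_ne_top] at h3
  exact ENNReal.toReal_le_of_le_ofReal hκ.le h3

lemma IsBigOP.exists_measureReal_le {Ω : ℕ → Type*} [∀ n, MeasurableSpace (Ω n)]
    {P : ∀ n, Measure (Ω n)} {f : ∀ n, Ω n → ℝ} {r : ℕ → ℝ} (h : IsBigOP P f r) {κ : ℝ}
    (hκ : 0 < κ) : ∃ M : ℝ, 0 < M ∧ ∀ᶠ n in atTop, (P n).real {ω | ¬ f n ω ≤ M * r n} ≤ κ
      := by
  obtain ⟨M, hM, h⟩ := h κ hκ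
  refine ⟨M, hM, h.mono fun n hn => ENNReal.toReal_le_of_le_ofReal hκ.le (le_trans ?_ hn)⟩
  refine measure_mono fun ω hω => ?_
  simp only [Set.mem_ofPred_eq, not_le] at hω ⊢
  exact hω.trans_le (le_abs_self _)

/-- Constants for the sandwich argument around the two normal quantiles. -/
lemma exists_gaussian_sandwich {α ε : ℝ} (hα0 : 0 < α) (hα1 : α < 1) (hε : 0 < ε) :
    ∃ a b η κ : ℝ, 0 < η ∧ 0 < κ ∧ κ ≤ ε ∧ a < b ∧
      α / 2 + 4 * κ < (gaussianReal 0 1).real (Set.Iic (a + η)) ∧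
      (gaussianReal 0 1).real (Set.Iic (a - η)) + 4 * κ < α / 2 ∧
      1 - α / 2 + 4 * κ < (gaussianReal 0 1).real (Set.Iic (b + η)) ∧
      (gaussianReal 0 1).real (Set.Iic (b - η)) + 4 * κ < 1 - α / 2 ∧
      1 - α - ε ≤ (gaussianReal 0 1).real (Set.Iic (b - 2 * η))
        - (gaussianReal 0 1).real (Set.Iic (a + 2 * η)) ∧
      (gaussianReal 0 1).real (Set.Iic (b + 2 * η))
        - (gaussianReal 0 1).real (Set.Iic (a - 3 * η)) ≤ 1 - α + ε := by
  obtain ⟨a, ha⟩ := exists_gaussianReal_Iic_eq (τ := α / 2) (by linarith) (by linarith)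
  obtain ⟨b, hb⟩ := exists_gaussianReal_Iic_eq (τ := 1 - α / 2) (by linarith) (by linarith)
  have hmono := strictMono_gaussianReal_Iic
  have hcont := continuous_gaussianReal_Iic
  set Φ : ℝ → ℝ := fun x => (gaussianReal 0 1).real (Set.Iic x) with hΦ
  change Φ a = _ at ha
  change Φ b = _ at hb
  have hab : a < b := hmono.lt_iff_lt.1 (by rw [ha, hb]; linarith)
  have hlim : ∀ x c : ℝ, Tendsto (fun η : ℝ => Φ (x + c * η)) (𝓝[>] 0) (𝓝 (Φ x)) := by
    intro x c
    have : Tendsto (fun η : ℝ => Φ (x + c * η)) (𝓝 0) (𝓝 (Φ (x + c * 0))) :=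
      (hcont.comp (by fun_prop)).tendsto 0
    rw [mul_zero, add_zero] at this
    exact this.mono_left nhdsWithin_le_nhds
  have l1 := (hlim b (-2)).sub (hlim a 2)
  have l2 := (hlim b 2).sub (hlim a (-3))
  rw [ha, hb] at l1 l2
  obtain ⟨η, ⟨hη1, hη2⟩, hη0⟩ := (((l1.eventually_const_lt (u := 1 - α - ε) (by linarith)).and
    (l2.eventually_lt_const (u := 1 - α + ε) (by linarith))).and self_mem_nhdsWithin).exists
  replace hη0 : 0 < η := hη0
  have m1 : Φ a < Φ (a + η) := hmono (by linarith)
  have m2 : Φ (a - η) < Φ a := hmono (by linarith)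
  have m3 : Φ b < Φ (b + η) := hmono (by linarith)
  have m4 : Φ (b - η) < Φ b := hmono (by linarith)
  -- A fifth of the smallest gap makes the four margins 4 κ strict.
  set κ := min ε (min (min (Φ (a + η) - Φ a) (Φ a - Φ (a - η)))
    (min (Φ (b + η) - Φ b) (Φ b - Φ (b - η))) / 5) with hκ
  have hκ0 : 0 < κ := by
    refine lt_min hε (div_pos (lt_min (lt_min ?_ ?_) (lt_min ?_ ?_)) (by norm_num)) <;> linarith
  have hκ' : 5 * κ ≤ min (min (Φ (a + η) - Φ a) (Φ a - Φ (a - η)))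
      (min (Φ (b + η) - Φ b) (Φ b - Φ (b - η))) := by
    have := min_le_right ε (min (min (Φ (a + η) - Φ a) (Φ a - Φ (a - η)))
      (min (Φ (b + η) - Φ b) (Φ b - Φ (b - η))) / 5)
    rw [← hκ] at this
    linarith
  rw [le_min_iff, le_min_iff, le_min_iff] at hκ'
  obtain ⟨⟨q1, q2⟩, q3, q4⟩ := hκ'
  refine ⟨a, b, η, κ, hη0, hκ0, min_le_left _ _, hab, ?_, ?_, ?_, ?_, ?_, ?_⟩
  · change _ < Φ (a + η); linarith
  · change Φ (a - η) + _ < _; linarith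
  · change _ < Φ (b + η); linarith
  · change Φ (b - η) + _ < _; linarith
  · change _ ≤ Φ (b - 2 * η) - Φ (a + 2 * η)
    rw [show b - 2 * η = b + -2 * η by ring]; exact hη1.le
  · change Φ (b + 2 * η) - Φ (a - 3 * η) ≤ _
    rw [show a - 3 * η = a + -3 * η by ring]; exact hη2.le

end DebiasedBayes

/-! ### The coverage theorem. -/

open DebiasedBayes
theorem corollary1
    -- for each sample size `n`: the dimension, the law of `(Y, X)`, the true coefficient vector
    (p : ℕ → ℕ) (hp : ∀ n, 2 ≤ p n)
    (μ : ∀ n, Measure (Obs (p n))) [∀ n, IsProbabilityMeasure (μ n)]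
    (β₀ : ∀ n, Fin (p n) → ℝ)
    -- the initial posterior and the estimator of the precision matrix, both functions of the data
    (Post : ∀ n, Kernel (Sample n (p n)) (Fin (p n) → ℝ)) [∀ n, IsMarkovKernel (Post n)]
    (Θhat : ∀ n, Sample n (p n) → Matrix (Fin (p n)) (Fin (p n)) ℝ)
    (hΘhat : ∀ n k l, Measurable fun z => Θhat n z k l)
    -- the coordinate of interest
    (j : ∀ n, Fin (p n))
    -- the precision matrix exists, and the model `Y = Xᵀ β₀ + ε`, `E₀[X ε] = 0` holds
    (hΩ : ∀ n, IsUnit (Omega0 (μ n)).det)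
    (hmodel : ∀ n k, ∫ z, z.2 k * err (β₀ n) z ∂(μ n) = 0)
    -- moment conditions, uniform in `n`
    (hX : ∃ K : ℝ, ∀ n, 0 < psi2NormVec (μ n) (fun z => z.2) ∧
      psi2NormVec (μ n) (fun z => z.2) ≤ ENNReal.ofReal K)
    (hε : ∃ K : ℝ, ∀ n, 0 < psi2Norm (μ n) (err (β₀ n)) ∧
      psi2Norm (μ n) (err (β₀ n)) ≤ ENNReal.ofReal K)
    (hthird : ∃ M : ℝ, ∀ n,
      ∫⁻ z, ENNReal.ofReal (|(Theta0 (μ n) *ᵥ z.2) (j n) * err (β₀ n) z| ^ 3) ∂(μ n)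
        ≤ ENNReal.ofReal M)
    -- contraction rate of the initial posterior
    (ε : ℕ → ℝ) (hεpos : ∀ n, 0 < ε n) (hεlim : Tendsto ε atTop (𝓝 0))
    (hcontr : ∃ C : ℝ, 0 < C ∧ Tendsto
      (fun n => ∫⁻ z, Post n z {b | C * ε n ≤ l1Norm (b - β₀ n)} ∂(sampleLaw n (μ n)))
      atTop (𝓝 0))
    -- convergence rate of the estimator of the precision matrix
    (γ δ : ℕ → ℝ) (hγpos : ∀ n, 0 < γ n) (hγlim : Tendsto γ atTop (𝓝 0))
    (hδpos : ∀ n, 0 < δ n) (hδlim : Tendsto δ atTop (𝓝 0))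
    (hΘγ : IsBigOP (fun n => sampleLaw n (μ n))
      (fun n z => maxNorm (Θhat n z * OmegaHat z - 1)) γ)
    (hΘδ : IsBigOP (fun n => sampleLaw n (μ n))
      (fun n z => opNormInf (Θhat n z - Theta0 (μ n))) δ)
    -- existence of a centering point estimator
    (hcenter : ∃ βhat : ∀ n, Sample n (p n) → Fin (p n) → ℝ, (∀ n, Measurable (βhat n)) ∧
      IsLittleOP (fun n => sampleLaw n (μ n))
        (fun n z => ‖expansionRemainder (μ n) (β₀ n) (βhat n z) z‖)
        (fun n => (√(n : ℝ))⁻¹))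
    -- rate conditions
    (hrate₁ : Tendsto (fun n : ℕ => √(n : ℝ) * ε n * γ n) atTop (𝓝 0))
    (hrate₂ : Tendsto (fun n : ℕ => √(n : ℝ) * (ε n * opNormInf (Theta0 (μ n)) + δ n) *
      (√(Real.log (p n) / n) + Real.log n ^ 2 * Real.log (p n) ^ 2 / n)) atTop (𝓝 0))
    -- the asymptotic variance is bounded away from zero
    (hσ : ∃ c : ℝ, 0 < c ∧ ∀ n, c ≤ sigmaSq (μ n) (β₀ n) (j n))
    (α : ℝ) (hα₀ : 0 < α) (hα₁ : α < 1) :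
    Tendsto
      (fun n => (sampleLaw n (μ n)).real
        {z | β₀ n (j n) ∈ credibleInterval (Post n) (Θhat n) z (j n) α})
      atTop (𝓝 (1 - α)) := by
  obtain ⟨KX, hKX⟩ := hX
  obtain ⟨Kε, hKε⟩ := hε
  obtain ⟨M₃, hM₃⟩ := hthird
  obtain ⟨C, hC, hcontr⟩ := hcontr
  obtain ⟨c, hc, hσ⟩ := hσ
  -- The added 1 provides the strict gap required by `expSqBound_of_psi2Norm_le`, and the maximum
  -- with 0 ensures positivity.
  set K := max (max KX Kε) 0 + 1 with hK
  have hK0 : 0 < K := by positivity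
  have hU : ∀ n k, ExpSqBound (μ n) (coordErr (β₀ n) k) K := by
    intro n k
    refine expSqBound_of_psi2Norm_le (K := max KX Kε) (measurable_coordErr _ k) ?_ hK0 ?_
    · rw [hK]; linarith [le_max_left (max KX Kε) 0]
    · cases k with
      | none => exact (hKε n).2.trans (ENNReal.ofReal_le_ofReal (le_max_right _ _))
      | some k =>
        exact (psi2Norm_coord_le_psi2NormVec (fun z : Obs (p n) => z.2) k).trans
          ((hKX n).2.trans (ENNReal.ofReal_le_ofReal (le_max_left _ _)))
  -- the studentized influence
  have hc' : 0 < √c := Real.sqrt_pos.2 hc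
  set σ : ℕ → ℝ := fun n => √(sigmaSq (μ n) (β₀ n) (j n)) with hσdef
  have hσc : ∀ n, √c ≤ σ n := fun n => Real.sqrt_le_sqrt (hσ n)
  have hσ0 : ∀ n, 0 < σ n := fun n => hc'.trans_le (hσc n)
  set ξ : ∀ n, Obs (p n) → ℝ := fun n => influence (Theta0 (μ n)) (β₀ n) (j n) with hξ
  set M := max M₃ 0 / √c ^ 3 with hM
  have hξm : ∀ n, Measurable (ξ n) := fun n => measurable_influence _ _ _
  -- The minus sign matches V, to which the central limit theorem for the data is applied.
  have hD1 : ∀ n, ∫ z, -(ξ n z / σ n) ∂(μ n) = 0 := fun n => by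
    rw [integral_neg, integral_div, integral_influence (hU n) hK0 (hmodel n)]
    simp
  have hD2 : ∀ n, ∫ z, (ξ n z / σ n) ^ 2 ∂(μ n) = 1 := fun n => by
    simp_rw [div_pow]
    rw [integral_div, integral_influence_sq (hU n) hK0,
      Real.sq_sqrt (hc.le.trans (hσ n)), div_self (hc.trans_le (hσ n)).ne']
  have hD3i : ∀ n, Integrable (fun z => |ξ n z / σ n| ^ 3) (μ n) := fun n => by
    simp_rw [abs_div, div_pow]
    exact (integrable_influence_cube (hM₃ n)).1.div_const _
  have hD3 : ∀ n, ∫ z, |ξ n z / σ n| ^ 3 ∂(μ n) ≤ M := fun n => by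
    simp_rw [abs_div, div_pow]
    rw [integral_div, abs_of_pos (hσ0 n), hM]
    exact div_le_div₀ (le_max_right _ _) (integrable_influence_cube (hM₃ n)).2 (by positivity)
      (pow_le_pow_left₀ hc'.le (hσc n) 3)
  have hDm : ∀ n, Measurable fun z => ξ n z / σ n := fun n => (hξm n).div_const _
  rw [Metric.tendsto_nhds]
  intro tol htol
  obtain ⟨a, b, η, κ, hη, hκ, hκtol, hab, g1, g2, g3, g4, g5, g6⟩ :=
    -- The error budget is one unit tol / 12 for the normal quantiles, 2 κ for the law of V and 8 κ
    -- for the eight bad events: eleven units at most.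
    exists_gaussian_sandwich hα₀ hα₁ (show 0 < tol / 12 by positivity)
  obtain ⟨Mγ, hMγ, evγ⟩ := hΘγ.exists_measureReal_le hκ
  obtain ⟨Mδ, hMδ, evδ⟩ := hΘδ.exists_measureReal_le hκ
  obtain ⟨Mρ, hMρ, hnoise⟩ := exists_noise_bound hK0 hκ
  obtain ⟨Cτ, hCτ, hmean⟩ := exists_pi_expMeasure_mean_bound hκ
  have hr0 : ∀ n, 0 ≤ noiseRate n (p n) := fun n => by unfold noiseRate; positivity
  have evrem := eventually_remainder_lt (C₁ := Cτ) (C₂ := C) (C₃ := Mγ) (C₄ := Mδ) (C₅ := Mρ)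
    hc' hσc hεpos hδpos (fun n => opNormInf_nonneg (Theta0 (μ n))) hr0 hCτ hC hMδ hMρ hη
    hεlim hrate₁ hrate₂
  have evcontr : ∀ᶠ n in atTop,
      ∫⁻ z, Post n z {b | C * ε n ≤ l1Norm (b - β₀ n)} ∂(sampleLaw n (μ n))
        ≤ ENNReal.ofReal (κ * κ) :=
    hcontr.eventually_le_const (ENNReal.ofReal_pos.2 (mul_pos hκ hκ))
  filter_upwards [evγ, evδ, evrem, evcontr, eventually_ge_atTop 3,
    (tendsto_const_div_sqrt_nat Cτ).eventually_lt_const one_pos,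
    eventually_normalized_sum_cdf_close (a + 2 * η) M hκ,
    eventually_normalized_sum_cdf_close (b - 2 * η) M hκ,
    eventually_normalized_sum_cdf_close (a - 3 * η) M hκ,
    eventually_normalized_sum_cdf_close (b + 2 * η) M hκ,
    eventually_bootstrap_sum_cdf_close (a + η) M hκ,
    eventually_bootstrap_sum_cdf_close (a - η) M hκ,
    eventually_bootstrap_sum_cdf_close (b + η) M hκ,
    eventually_bootstrap_sum_cdf_close (b - η) M hκ] with n eγ eδ erem econtr hn3 eτ
    s1 s2 s3 s4 w1 w2 w3 w4
  have hn0 : 0 < n := by omega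
  have hcl := measureReal_kernel_gt_le (Post n) (measurableSet_le_l1Norm (β₀ n) (C * ε n)) hκ econtr
  have hno := hnoise n (p n) hn3 (hp n) (μ n) (β₀ n) (hU n) (hmodel n)
  replace w1 := w1 (μ n) _ (hDm n) (hD3i n) (hD3 n) (hD2 n)
  replace w2 := w2 (μ n) _ (hDm n) (hD3i n) (hD3 n) (hD2 n)
  replace w3 := w3 (μ n) _ (hDm n) (hD3i n) (hD3 n) (hD2 n)
  replace w4 := w4 (μ n) _ (hDm n) (hD3i n) (hD3 n) (hD2 n)
  set V : Sample n (p n) → ℝ := fun z => -∑ i, ξ n (z i) / (σ n * √n) with hV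
  have hVm : Measurable V := by
    have := hξm n
    fun_prop
  have eV : ∀ z, ∑ i, -(ξ n (z i) / σ n) / √n = V z := fun z => by
    simp only [hV]
    rw [← Finset.sum_neg_distrib]
    exact Finset.sum_congr rfl fun i _ => by rw [neg_div, div_div]
  have hDneg : ∀ n, Integrable (fun z => |-(ξ n z / σ n)| ^ 3) (μ n) ∧
      ∫ z, |-(ξ n z / σ n)| ^ 3 ∂(μ n) ≤ M ∧ ∫ z, (-(ξ n z / σ n)) ^ 2 ∂(μ n) = 1 := fun n => by
    simp only [abs_neg, neg_sq]
    exact ⟨hD3i n, hD3 n, hD2 n⟩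
  replace s1 := s1 (μ n) _ (hDm n).neg (hDneg n).1 (hDneg n).2.1 (hD1 n) (hDneg n).2.2
  replace s2 := s2 (μ n) _ (hDm n).neg (hDneg n).1 (hDneg n).2.1 (hD1 n) (hDneg n).2.2
  replace s3 := s3 (μ n) _ (hDm n).neg (hDneg n).1 (hDneg n).2.1 (hD1 n) (hDneg n).2.2
  replace s4 := s4 (μ n) _ (hDm n).neg (hDneg n).1 (hDneg n).2.1 (hD1 n) (hDneg n).2.2
  simp only [Pi.neg_apply, eV] at s1 s2 s3 s4
  simp only [div_div] at w1 w2 w3 w4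
  have hbad := (measureReal_union_le (μ := sampleLaw n (μ n)) _ _).trans (add_le_add
    ((measureReal_union_le _ _).trans (add_le_add hcl hno))
    ((measureReal_union_le _ _).trans (add_le_add
      ((measureReal_union_le _ _).trans (add_le_add eγ eδ))
      ((measureReal_union_le _ _).trans (add_le_add
        ((measureReal_union_le _ _).trans (add_le_add w1 w2))
        ((measureReal_union_le _ _).trans (add_le_add w3 w4)))))))
  refine lt_of_le_of_lt (abs_measureReal_sub_le_of_sandwich (P := sampleLaw n (μ n)) hVm
    (Φ := fun x => (gaussianReal 0 1).real (Set.Iic x)) hη hbad (fun z hz => ?_) s1 s2 s3 s4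
    (by linarith) g5 g6) (by linarith)
  -- Off the bad events the data satisfy posterior contraction, the score and weight noise bounds,
  -- both rates for Θ̂, and the conditional normal approximation at a ± η and b ± η.
  simp only [Set.mem_union, Set.mem_ofPred_eq, not_or, not_not] at hz
  obtain ⟨⟨z1, z2, z3⟩, ⟨z4, z5⟩, ⟨z6, z7⟩, z8, z9⟩ := hz
  obtain ⟨hup, hlow⟩ := coordLaw_cdf_compare (Post n) (Θhat n) z (j n) (Theta0 (μ n)) (β₀ n) hn0
    (hσ0 n) (mul_nonneg hMρ.le (hr0 n)) eτ z1 z4 z5 z2 z3 (hmean n hn0) erem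
  exact mem_Icc_quantile_of_cdf_bounds (ν := coordLaw (Post n) (Θhat n) z (j n))
    (G := fun x => (Measure.pi fun _ : Fin n => expMeasure 1).real
      {ω | ∑ i, ξ n (z i) / (σ n * √n) * (ω i - 1) ≤ x})
    (Φ := fun x => (gaussianReal 0 1).real (Set.Iic x)) hα₀ hα₁ hup hlow z6 z7 z8 z9 g1 g2 g3 g4
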